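/- Let $p$ be a prime, $S$ a finite $p$-group, and $\mathcal F$ a saturated fusion system on $S$. Let $A(S)$ be the Burnside ring of $S$, i.e. the Grothendieck ring of the semiring of isomorphism classes of finite $S$-sets (with disjoint union as addition and cartesian product as multiplication), and for $Q\le S$ let $\Phi_Q\colon A(S)\to\mathbb Z$ be the ring homomorphism with $\Phi_Q([X])=|X^Q|$ for every finite $S$-set $X$. Let $A(\mathcal F)\subseteq A(S)$ be the subring of $\mathcal F$-stable elements, i.e. of those $X\in A(S)$ such that for every $P\le S$ and every morphism $\varphi\colon P\to S$ of $\mathcal F$, the restrictions of $X$ to $A(P)$ along $\varphi$ and along the inclusion $P\le S$ agree. Write $(-)_{(p)}$ for $p$-localization (inverting the integers prime to $p$), regard $A(\mathcal F)_{(p)}$ as a subring of $A(S)_{(p)}$, and write $\Phi_Q\colon A(S)_{(p)}\to\mathbb Z_{(p)}\subseteq\mathbb Q$ also for the induced homomorphism. For $Q\le S$ let $[Q]_{\mathcal F}$ be the set of subgroups of $S$ that are $\mathcal F$-conjugate to $Q$. Then for each $X\in A(S)_{(p)}$ there is an element $\pi(X)\in A(\mathcal F)_{(p)}$ such that $$\Phi_Q(\pi(X))=\frac1{|[Q]_{\mathcal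 F}|}\sum_{Q'\in[Q]_{\mathcal F}}\Phi_{Q'}(X)\qquad\text{for all }Q\le S,$$ and $\pi(X)$ is the only element of $A(S)_{(p)}$ with these marks. The resulting map $\pi\colon A(S)_{(p)}\to A(\mathcal F)_{(p)}$ is a homomorphism of $A(\mathcal F)_{(p)}$-modules and restricts to the identity on $A(\mathcal F)_{(p)}$. -/

import Mathlib

universe u

noncomputable section

/-! ### The Grothendieck ring of a commutative semiring -/

/-- The Grothendieck ring of a commutative semiring: the Grothendieck group of its additive monoid,
with the multiplication extended biadditively. -/
def GrothendieckRing (R : Type*) [CommSemiring R] : Type _ := Algebra.GrothendieckAddGroup R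

namespace GrothendieckRing

variable {R : Type*} [CommSemiring R]

instance : AddCommGroup (GrothendieckRing R) :=
  inferInstanceAs (AddCommGroup (Algebra.GrothendieckAddGroup R))

/-- The canonical map to the Grothendieck ring, as an additive map. -/
def ofAdd : R →+ GrothendieckRing R := (Algebra.GrothendieckAddGroup.of : R →+ _)

/-- The universal property of the additive group. -/
def liftAdd {B : Type*} [AddCommGroup B] (f : R →+ B) : GrothendieckRing R →+ B :=
  Algebra.GrothendieckAddGroup.lift f

theorem liftAdd_of {B : Type*} [AddCommGroup B] (f : R →+ B) (a : R) :
    liftAdd f (ofAdd a) = f a :=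
  DFunLike.congr_fun (Algebra.GrothendieckAddGroup.lift.symm_apply_apply f) a

theorem hom_ext {B : Type*} [AddCommGroup B] {f g : GrothendieckRing R →+ B}
    (h : ∀ a, f (ofAdd a) = g (ofAdd a)) : f = g :=
  Algebra.GrothendieckAddGroup.lift.symm.injective (DFunLike.ext _ _ h)

/-- Every element is a difference of two elements of the semiring. -/
theorem exists_sub (x : GrothendieckRing R) : ∃ a b : R, x = ofAdd a - ofAdd b := by
  let H : AddSubgroup (GrothendieckRing R) :=
    { carrier := {x | ∃ a b : R, x = ofAdd a - ofAdd b}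
      zero_mem' := ⟨0, 0, by simp⟩
      add_mem' := by
        rintro _ _ ⟨a, b, rfl⟩ ⟨c, d, rfl⟩
        exact ⟨a + c, b + d, by simp only [map_add]; abel⟩
      neg_mem' := by
        rintro _ ⟨a, b, rfl⟩
        exact ⟨b, a, by abel⟩ }
  have h : QuotientAddGroup.mk' H = 0 := hom_ext fun a =>
    (QuotientAddGroup.eq_zero_iff _).2 ⟨a, 0, by simp⟩
  exact (QuotientAddGroup.eq_zero_iff x).1 (DFunLike.congr_fun h x)

/-- The biadditive extension of the multiplication. -/
def mulHom : GrothendieckRing R →+ GrothendieckRing R →+ GrothendieckRing R :=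
  liftAdd
    { toFun := fun a => liftAdd (ofAdd.comp (AddMonoidHom.mulLeft a))
      map_zero' := hom_ext fun b => by simp [liftAdd_of]
      map_add' := fun a a' => hom_ext fun b => by simp [liftAdd_of, add_mul] }

theorem mulHom_of (a b : R) : mulHom (ofAdd a) (ofAdd b) = ofAdd (a * b) := by
  rw [mulHom, liftAdd_of]
  exact liftAdd_of _ _

instance : Mul (GrothendieckRing R) := ⟨fun x y => mulHom x y⟩

instance : One (GrothendieckRing R) := ⟨ofAdd 1⟩

theorem of_mul_of (a b : R) : (ofAdd a * ofAdd b : GrothendieckRing R) = ofAdd (a * b) :=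
  mulHom_of a b

theorem mul_add_aux (x y z : GrothendieckRing R) : x * (y + z) = x * y + x * z :=
  map_add (mulHom x) y z

theorem add_mul_aux (x y z : GrothendieckRing R) : (x + y) * z = x * z + y * z :=
  DFunLike.congr_fun (map_add mulHom x y) z

theorem mul_sub_aux (x y z : GrothendieckRing R) : x * (y - z) = x * y - x * z :=
  map_sub (mulHom x) y z

theorem sub_mul_aux (x y z : GrothendieckRing R) : (x - y) * z = x * z - y * z :=
  DFunLike.congr_fun (map_sub mulHom x y) z

instance : CommRing (GrothendieckRing R) where
  __ := (inferInstance : AddCommGroup (GrothendieckRing R))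
  left_distrib := mul_add_aux
  right_distrib := add_mul_aux
  zero_mul x := DFunLike.congr_fun (map_zero mulHom) x
  mul_zero x := map_zero (mulHom x)
  mul_assoc x y z := by
    obtain ⟨a, b, rfl⟩ := exists_sub x
    obtain ⟨c, d, rfl⟩ := exists_sub y
    obtain ⟨e, f, rfl⟩ := exists_sub z
    simp only [mul_sub_aux, sub_mul_aux, of_mul_of, mul_assoc]
  one_mul x := by
    obtain ⟨a, b, rfl⟩ := exists_sub x
    change ofAdd 1 * (_ : GrothendieckRing R) = _
    simp only [mul_sub_aux, of_mul_of, one_mul]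
  mul_one x := by
    obtain ⟨a, b, rfl⟩ := exists_sub x
    change (_ : GrothendieckRing R) * ofAdd 1 = _
    simp only [sub_mul_aux, of_mul_of, mul_one]
  mul_comm x y := by
    obtain ⟨a, b, rfl⟩ := exists_sub x
    obtain ⟨c, d, rfl⟩ := exists_sub y
    simp only [mul_sub_aux, sub_mul_aux, of_mul_of, mul_comm]
    abel

/-- The canonical semiring homomorphism to the Grothendieck ring. -/
def of : R →+* GrothendieckRing R :=
  { ofAdd with
    map_one' := rfl
    map_mul' := fun a b => (of_mul_of a b).symm }

/-- The universal property of the Grothendieck ring. -/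
def lift {B : Type*} [CommRing B] (f : R →+* B) : GrothendieckRing R →+* B :=
  { liftAdd (f : R →+ B) with
    map_one' := (liftAdd_of (f : R →+ B) 1).trans (map_one f)
    map_mul' := fun x y => by
      obtain ⟨a, b, rfl⟩ := exists_sub x
      obtain ⟨c, d, rfl⟩ := exists_sub y
      change liftAdd (f : R →+ B) _ = liftAdd (f : R →+ B) _ * liftAdd (f : R →+ B) _
      simp only [mul_sub_aux, sub_mul_aux, of_mul_of, map_sub, liftAdd_of,
        AddMonoidHom.coe_coe, map_mul]
      ring }

theorem lift_of {B : Type*} [CommRing B] (f : R →+* B) (a : R) : lift f (of a) = f a :=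
  liftAdd_of (f : R →+ B) a

end GrothendieckRing

/-! ### The Burnside ring of a group -/

/-- A finite set with an action of the group `G`. -/
structure FinGSet (G : Type u) [Group G] : Type (u + 1) where
  carrier : Type u
  [finite : Finite carrier]
  [action : MulAction G carrier]

attribute [instance] FinGSet.finite FinGSet.action

namespace FinGSet

variable {G : Type u} [Group G]

/-- Isomorphism of `G`-sets. -/
def IsIso (X Y : FinGSet G) : Prop :=
  ∃ e : X.carrier ≃ Y.carrier, ∀ (g : G) (x : X.carrier), e (g • x) = g • e x

instance setoid (G : Type u) [Group G] : Setoid (FinGSet G) where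
  r := IsIso
  iseqv :=
    { refl := fun _ => ⟨Equiv.refl _, fun _ _ => rfl⟩
      symm := by
        rintro X Y ⟨e, he⟩
        exact ⟨e.symm, fun g y => by
          rw [Equiv.symm_apply_eq, he, Equiv.apply_symm_apply]⟩
      trans := by
        rintro X Y Z ⟨e, he⟩ ⟨f, hf⟩
        exact ⟨e.trans f, fun g x => by simp [he, hf]⟩ }

/-- The empty `G`-set. -/
def empty (G : Type u) [Group G] : FinGSet G :=
  letI : MulAction G PEmpty.{u + 1} :=
    { smul := fun _ x => x, one_smul := fun _ => rfl, mul_smul := fun _ _ _ => rfl }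
  ⟨PEmpty.{u + 1}⟩

/-- The one-point `G`-set. -/
def point (G : Type u) [Group G] : FinGSet G := ⟨PUnit.{u + 1}⟩

/-- Disjoint union. -/
def sum (X Y : FinGSet G) : FinGSet G := ⟨X.carrier ⊕ Y.carrier⟩

/-- Cartesian product with the diagonal action. -/
def prod (X Y : FinGSet G) : FinGSet G := ⟨X.carrier × Y.carrier⟩

/-- Restriction of the action along a group homomorphism `f`, i.e. `g • x := f g • x`. -/
def res {H : Type u} [Group H] (f : H →* G) (X : FinGSet G) : FinGSet H :=
  letI : MulAction H X.carrier := MulAction.compHom X.carrier f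
  ⟨X.carrier⟩

/-- The number of fixed points of the subgroup `P`. -/
def fixCard (P : Subgroup G) (X : FinGSet G) : ℕ := Nat.card (MulAction.fixedPoints P X.carrier)

end FinGSet

/-- Isomorphism classes of finite `G`-sets. -/
def FinGSetClass (G : Type u) [Group G] : Type (u + 1) := Quotient (FinGSet.setoid G)

namespace FinGSetClass

variable {G : Type u} [Group G]

instance : Add (FinGSetClass G) :=
  ⟨Quotient.map₂ FinGSet.sum (by
    rintro X X' ⟨e, he⟩ Y Y' ⟨f, hf⟩
    refine ⟨Equiv.sumCongr e f, ?_⟩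
    rintro g (x | y)
    · exact congrArg Sum.inl (he g x)
    · exact congrArg Sum.inr (hf g y))⟩

instance : Mul (FinGSetClass G) :=
  ⟨Quotient.map₂ FinGSet.prod (by
    rintro X X' ⟨e, he⟩ Y Y' ⟨f, hf⟩
    exact ⟨Equiv.prodCongr e f, fun g x => Prod.ext (he g x.1) (hf g x.2)⟩)⟩

instance : Zero (FinGSetClass G) := ⟨Quotient.mk _ (FinGSet.empty G)⟩

instance : One (FinGSetClass G) := ⟨Quotient.mk _ (FinGSet.point G)⟩

/-- Isomorphism classes of finite `G`-sets form a commutative semiring under disjoint union and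
cartesian product. -/
instance : CommSemiring (FinGSetClass G) where
  add_assoc := by
    rintro ⟨X⟩ ⟨Y⟩ ⟨Z⟩
    refine Quotient.sound ⟨Equiv.sumAssoc _ _ _, ?_⟩
    rintro g ((x | x) | x) <;> rfl
  zero_add := by
    rintro ⟨X⟩
    refine Quotient.sound ⟨Equiv.emptySum PEmpty _, ?_⟩
    rintro g (x | x)
    · exact x.elim
    · rfl
  add_zero := by
    rintro ⟨X⟩
    refine Quotient.sound ⟨Equiv.sumEmpty _ PEmpty, ?_⟩
    rintro g (x | x)
    · rfl
    · exact x.elim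
  add_comm := by
    rintro ⟨X⟩ ⟨Y⟩
    refine Quotient.sound ⟨Equiv.sumComm _ _, ?_⟩
    rintro g (x | x) <;> rfl
  mul_assoc := by
    rintro ⟨X⟩ ⟨Y⟩ ⟨Z⟩
    exact Quotient.sound ⟨Equiv.prodAssoc _ _ _, fun _ _ => rfl⟩
  mul_comm := by
    rintro ⟨X⟩ ⟨Y⟩
    exact Quotient.sound ⟨Equiv.prodComm _ _, fun _ _ => rfl⟩
  one_mul := by
    rintro ⟨X⟩
    exact Quotient.sound ⟨Equiv.punitProd _, fun _ _ => rfl⟩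
  mul_one := by
    rintro ⟨X⟩
    exact Quotient.sound ⟨Equiv.prodPUnit _, fun _ _ => rfl⟩
  zero_mul := by
    rintro ⟨X⟩
    exact Quotient.sound ⟨Equiv.pemptyProd _, fun _ x => x.1.elim⟩
  mul_zero := by
    rintro ⟨X⟩
    exact Quotient.sound ⟨Equiv.prodPEmpty _, fun _ x => x.2.elim⟩
  left_distrib := by
    rintro ⟨X⟩ ⟨Y⟩ ⟨Z⟩
    refine Quotient.sound ⟨Equiv.prodSumDistrib _ _ _, ?_⟩
    rintro g ⟨x, y | y⟩ <;> rfl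
  right_distrib := by
    rintro ⟨X⟩ ⟨Y⟩ ⟨Z⟩
    refine Quotient.sound ⟨Equiv.sumProdDistrib _ _ _, ?_⟩
    rintro g ⟨x | x, y⟩ <;> rfl
  nsmul := nsmulRec

/-- Restriction along a group homomorphism, on isomorphism classes. -/
def res {H : Type u} [Group H] (f : H →* G) : FinGSetClass G →+* FinGSetClass H where
  toFun := Quotient.map (FinGSet.res f) (by
    rintro X Y ⟨e, he⟩
    exact ⟨e, fun h x => he (f h) x⟩)
  map_one' := Quotient.sound ⟨Equiv.refl _, fun _ _ => rfl⟩
  map_zero' := Quotient.sound ⟨Equiv.refl _, fun _ _ => rfl⟩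
  map_mul' := by
    rintro ⟨X⟩ ⟨Y⟩
    exact Quotient.sound ⟨Equiv.refl _, fun _ _ => rfl⟩
  map_add' := by
    rintro ⟨X⟩ ⟨Y⟩
    refine Quotient.sound ⟨Equiv.refl _, ?_⟩
    rintro g (x | x) <;> rfl

/-- The number of fixed points of the subgroup `P`, on isomorphism classes. -/
def mark (P : Subgroup G) : FinGSetClass G →+* ℕ where
  toFun := Quotient.lift (FinGSet.fixCard P) (by
    rintro X Y ⟨e, he⟩
    refine Nat.card_congr (e.subtypeEquiv fun x => forall_congr' fun g => ?_)
    exact e.injective.eq_iff.symm.trans (Eq.congr_left (he g x)))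
  map_one' := by
    refine (Nat.card_congr (Equiv.subtypeUnivEquiv fun x => ?_)).trans
      (Nat.card_unique (α := PUnit.{u + 1}))
    exact fun _ => rfl
  map_zero' :=
    haveI : IsEmpty (MulAction.fixedPoints P (FinGSet.empty G).carrier) := ⟨fun x => x.1.elim⟩
    Nat.card_of_isEmpty
  map_mul' := by
    rintro ⟨X⟩ ⟨Y⟩
    refine (Nat.card_congr ?_).trans (Nat.card_prod (MulAction.fixedPoints P X.carrier)
      (MulAction.fixedPoints P Y.carrier))
    exact
      { toFun := fun z => (⟨z.1.1, fun g => congrArg Prod.fst (z.2 g)⟩,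
          ⟨z.1.2, fun g => congrArg Prod.snd (z.2 g)⟩)
        invFun := fun z => ⟨(z.1.1, z.2.1), fun g => Prod.ext (z.1.2 g) (z.2.2 g)⟩
        left_inv := fun _ => rfl
        right_inv := fun _ => rfl }
  map_add' := by
    rintro ⟨X⟩ ⟨Y⟩
    refine (Nat.card_congr ?_).trans (Nat.card_sum (α := MulAction.fixedPoints P X.carrier)
      (β := MulAction.fixedPoints P Y.carrier))
    exact
      { toFun := fun z => match z with
          | ⟨Sum.inl x, h⟩ => Sum.inl ⟨x, fun g => Sum.inl_injective (h g)⟩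
          | ⟨Sum.inr y, h⟩ => Sum.inr ⟨y, fun g => Sum.inr_injective (h g)⟩
        invFun := fun z => match z with
          | Sum.inl x => ⟨Sum.inl x.1, fun g => congrArg Sum.inl (x.2 g)⟩
          | Sum.inr y => ⟨Sum.inr y.1, fun g => congrArg Sum.inr (y.2 g)⟩
        left_inv := by rintro ⟨x | y, h⟩ <;> rfl
        right_inv := by rintro (x | y) <;> rfl }

end FinGSetClass

/-- The Burnside ring `A(G)`: the Grothendieck ring of the semiring of isomorphism classes of finite
`G`-sets. -/
abbrev BurnsideRing (G : Type u) [Group G] : Type (u + 1) := GrothendieckRing (FinGSetClass G)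

namespace BurnsideRing

variable {G : Type u} [Group G]

/-- The restriction homomorphism `A(G) → A(H)` along a group homomorphism `H → G`. -/
def res {H : Type u} [Group H] (f : H →* G) : BurnsideRing G →+* BurnsideRing H :=
  GrothendieckRing.lift (GrothendieckRing.of.comp (FinGSetClass.res f))

/-- The mark homomorphism `Φ_P : A(G) → ℤ`, with `Φ_P [X] = |X^P|` for every finite `G`-set `X`. -/
def mark (P : Subgroup G) : BurnsideRing G →+* ℤ :=
  GrothendieckRing.lift ((Nat.castRingHom ℤ).comp (FinGSetClass.mark P))

end BurnsideRing

/-! ### `p`-localization -/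

/-- The integers that are not divisible by `p`. -/
def primeToP (p : ℕ) [hp : Fact p.Prime] : Submonoid ℤ where
  carrier := {n | ¬ (p : ℤ) ∣ n}
  one_mem' := (Nat.prime_iff_prime_int.1 hp.out).not_dvd_one
  mul_mem' ha hb := (Nat.prime_iff_prime_int.1 hp.out).not_dvd_mul ha hb

/-- The `p`-localization `A_(p)` of a commutative ring `A`: the integers prime to `p` are
inverted. -/
abbrev PLocal (p : ℕ) [Fact p.Prime] (A : Type*) [CommRing A] : Type _ :=
  Localization (Algebra.algebraMapSubmonoid A (primeToP p))

theorem algebraMapSubmonoid_primeToP_le (p : ℕ) [Fact p.Prime] {A B : Type*} [CommRing A]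
    [CommRing B] (f : A →+* B) :
    Algebra.algebraMapSubmonoid A (primeToP p) ≤
      (Algebra.algebraMapSubmonoid B (primeToP p)).comap f := by
  rintro _ ⟨n, hn, rfl⟩
  exact ⟨n, hn, by simp⟩

/-- The homomorphism `A_(p) → B_(p)` induced by `A → B`. -/
def PLocal.map (p : ℕ) [Fact p.Prime] {A B : Type*} [CommRing A] [CommRing B] (f : A →+* B) :
    PLocal p A →+* PLocal p B :=
  IsLocalization.map (PLocal p B) f (algebraMapSubmonoid_primeToP_le p f)

theorem PLocal.map_injective (p : ℕ) [Fact p.Prime] {A B : Type*} [CommRing A] [CommRing B]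
    (f : A →+* B) (hf : Function.Injective f) : Function.Injective (PLocal.map p f) := by
  have h : Algebra.algebraMapSubmonoid B (primeToP p) =
      (Algebra.algebraMapSubmonoid A (primeToP p)).map f := by
    ext x
    simp [Algebra.algebraMapSubmonoid]
  rw [injective_iff_map_eq_zero]
  intro x hx
  obtain ⟨⟨a, s⟩, rfl⟩ := IsLocalization.mk'_surjective
    (Algebra.algebraMapSubmonoid A (primeToP p)) x
  rw [PLocal.map, IsLocalization.map_mk', IsLocalization.mk'_eq_zero_iff] at hx
  obtain ⟨⟨_, t⟩, ht⟩ := hx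
  rw [h] at t
  obtain ⟨m, hm, rfl⟩ := t
  rw [IsLocalization.mk'_eq_zero_iff]
  exact ⟨⟨m, hm⟩, hf (by simpa using ht)⟩

/-- The mark homomorphism `Φ_P` on `A(G)_(p)`. Its values lie in `ℤ_(p)`; they are regarded as
rational numbers. -/
def BurnsideRing.pMark (p : ℕ) [Fact p.Prime] {G : Type u} [Group G] (P : Subgroup G) :
    PLocal p (BurnsideRing G) →+* ℚ :=
  IsLocalization.lift (M := Algebra.algebraMapSubmonoid (BurnsideRing G) (primeToP p))
    (g := (Int.castRingHom ℚ).comp (BurnsideRing.mark P)) (by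
      rintro ⟨_, n, hn, rfl⟩
      have h : n ≠ 0 := by
        rintro rfl
        exact hn (dvd_zero _)
      simpa using h)

/-! ### Fusion systems -/

/-- The conjugation homomorphism `c_s : P → Q`, `x ↦ s x s⁻¹`, when `s P s⁻¹ ≤ Q`. -/
def conjHom {S : Type u} [Group S] (P Q : Subgroup S) (s : S) (h : ∀ x ∈ P, s * x * s⁻¹ ∈ Q) :
    P →* Q where
  toFun x := ⟨s * x * s⁻¹, h x x.2⟩
  map_one' := Subtype.ext (by simp)
  map_mul' x y := Subtype.ext (by simp)

/-- The image `φ(P)` of a homomorphism `φ : P → Q`, as a subgroup of `S`. -/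
abbrev homImage {S : Type u} [Group S] {P Q : Subgroup S} (φ : P →* Q) : Subgroup S :=
  (Q.subtype.comp φ).range

/-- A homomorphism `φ : P → Q` regarded as a homomorphism `P → φ(P)`. -/
abbrev toHomImage {S : Type u} [Group S] {P Q : Subgroup S} (φ : P →* Q) : P →* homImage φ :=
  (Q.subtype.comp φ).rangeRestrict

/-- A fusion system on a group `S`: a category whose objects are the subgroups of `S` and whose
morphisms are injective group homomorphisms. Identities are conjugations by `1`. -/
structure FusionSystem (S : Type u) [Group S] where
  /-- The set of morphisms from `P` to `Q`. -/
  hom : ∀ P Q : Subgroup S, Set (P →* Q)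
  injective : ∀ {P Q : Subgroup S} {φ : P →* Q}, φ ∈ hom P Q → Function.Injective φ
  comp_mem : ∀ {P Q R : Subgroup S} {φ : P →* Q} {ψ : Q →* R},
    φ ∈ hom P Q → ψ ∈ hom Q R → ψ.comp φ ∈ hom P R
  conj_mem : ∀ (P Q : Subgroup S) (s : S) (h : ∀ x ∈ P, s * x * s⁻¹ ∈ Q),
    conjHom P Q s h ∈ hom P Q
  toImage_mem : ∀ {P Q : Subgroup S} {φ : P →* Q}, φ ∈ hom P Q →
    toHomImage φ ∈ hom P (homImage φ)
  /-- The inverse `φ(P) → P` of a morphism is a morphism. -/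
  inv_mem : ∀ {P Q : Subgroup S} {φ : P →* Q} (hφ : φ ∈ hom P Q),
    (MonoidHom.ofInjective (f := Q.subtype.comp φ)
      (Q.subtype_injective.comp (injective hφ))).symm.toMonoidHom ∈ hom (homImage φ) P

namespace FusionSystem

variable {S : Type u} [Group S] (F : FusionSystem S)

/-- `P` and `Q` are `F`-conjugate if some morphism from `P` to `Q` is a group isomorphism. -/
def IsConj (P Q : Subgroup S) : Prop := ∃ φ ∈ F.hom P Q, Function.Bijective φ

/-- The `F`-conjugacy class `[P]_F`. -/
def conjClass [Finite S] (P : Subgroup S) : Finset (Subgroup S) :=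
  (Set.toFinite {Q | F.IsConj P Q}).toFinset

/-- `P` is fully `F`-normalized. -/
def FullyNormalized (P : Subgroup S) : Prop :=
  ∀ Q, F.IsConj P Q →
    Nat.card (Subgroup.normalizer (Q : Set S)) ≤ Nat.card (Subgroup.normalizer (P : Set S))

/-- `P` is fully `F`-centralized. -/
def FullyCentralized (P : Subgroup S) : Prop :=
  ∀ Q, F.IsConj P Q →
    Nat.card (Subgroup.centralizer (Q : Set S)) ≤ Nat.card (Subgroup.centralizer (P : Set S))

/-- The group `Aut_F(P)`. -/
def aut (P : Subgroup S) : Subgroup (MulAut P) where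
  carrier := {α | α.toMonoidHom ∈ F.hom P P}
  one_mem' := by
    have e : conjHom P P 1 (by simp) = (1 : MulAut P).toMonoidHom := by
      ext x
      simp [conjHom]
    change (1 : MulAut P).toMonoidHom ∈ F.hom P P
    rw [← e]
    exact F.conj_mem P P 1 (by simp)
  mul_mem' {α β} hα hβ := F.comp_mem (φ := β.toMonoidHom) (ψ := α.toMonoidHom) hβ hα
  inv_mem' {α} hα := by
    have hle : ∀ x ∈ P, (1 : S) * x * 1⁻¹ ∈ homImage α.toMonoidHom := fun x hx =>
      ⟨α.symm ⟨x, hx⟩, by simp⟩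
    have h := F.comp_mem (F.conj_mem P _ 1 hle) (F.inv_mem (φ := α.toMonoidHom) hα)
    let m := MonoidHom.ofInjective (f := P.subtype.comp α.toMonoidHom)
      (P.subtype_injective.comp (F.injective hα))
    have e : m.symm.toMonoidHom.comp (conjHom P (homImage α.toMonoidHom) 1 hle) =
        (α⁻¹ : MulAut P).toMonoidHom := by
      refine MonoidHom.ext fun x => m.injective ((m.apply_symm_apply _).trans (Subtype.ext ?_))
      change (1 : S) * x * 1⁻¹ = ((α (α.symm x) : P) : S)
      simp
    change (α⁻¹ : MulAut P).toMonoidHom ∈ F.hom P P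
    rw [← e]
    exact h

/-- The group `Aut_S(P)` of automorphisms of `P` induced by conjugation in `S`. -/
def autS (P : Subgroup S) : Subgroup (MulAut P) := P.normalizerMonoidHom.range

/-- The subgroup `N_φ = {x ∈ N_S(P) | ∃ y ∈ S, φ ∘ c_x = c_y ∘ φ}`. The variable `h` below is the
element `c_x(g)` of `P`. -/
def extender {P Q : Subgroup S} (φ : P →* Q) : Subgroup S where
  carrier := {x | x ∈ Subgroup.normalizer (P : Set S) ∧
    ∃ y : S, ∀ g h : P, (h : S) = x * g * x⁻¹ → (φ h : S) = y * φ g * y⁻¹}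
  one_mem' := ⟨one_mem _, 1, fun g h e => by
    have : h = g := Subtype.ext (by simpa using e)
    simp [this]⟩
  mul_mem' := by
    rintro a b ⟨ha, y, hy⟩ ⟨hb, z, hz⟩
    refine ⟨mul_mem ha hb, y * z, fun g h e => ?_⟩
    have hk : b * (g : S) * b⁻¹ ∈ P := (Subgroup.mem_normalizer_iff.1 hb _).1 g.2
    rw [hy ⟨_, hk⟩ h (by rw [e]; group), hz g ⟨_, hk⟩ rfl]
    group
  inv_mem' := by
    rintro a ⟨ha, y, hy⟩
    refine ⟨Subgroup.inv_mem _ ha, y⁻¹, fun g h e => ?_⟩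
    rw [hy h g (by rw [e]; group)]
    group

theorem le_extender {P Q : Subgroup S} (φ : P →* Q) : P ≤ extender φ := by
  intro x hx
  refine ⟨Subgroup.le_normalizer hx, φ ⟨x, hx⟩, fun g h e => ?_⟩
  have : h = ⟨x, hx⟩ * g * ⟨x, hx⟩⁻¹ := Subtype.ext (by simpa using e)
  simp [this]

/-- A fusion system on a `p`-group `S` is saturated if every fully normalized subgroup `P` is fully
centralized with `Aut_S(P)` a Sylow `p`-subgroup of `Aut_F(P)`, and every morphism `φ : P → S` with
fully centralized image extends to a morphism `N_φ → S`. -/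
structure IsSaturated (p : ℕ) : Prop where
  fullyCentralized : ∀ P, F.FullyNormalized P → F.FullyCentralized P
  sylow : ∀ P, F.FullyNormalized P →
    ∃ T : Sylow p (F.aut P), (T : Subgroup (F.aut P)) = (autS P).subgroupOf (F.aut P)
  extend : ∀ (P : Subgroup S), ∀ φ ∈ F.hom P ⊤, F.FullyCentralized (homImage φ) →
    ∃ ψ ∈ F.hom (extender φ) ⊤, ψ.comp (Subgroup.inclusion (le_extender φ)) = φ

/-- The Burnside ring `A(F)`: the subring of `F`-stable elements of `A(S)`, those whose restriction
along every morphism `φ : P → S` of `F` equals the restriction along the inclusion. -/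
def burnside : Subring (BurnsideRing S) where
  carrier := {X | ∀ (P : Subgroup S), ∀ φ ∈ F.hom P ⊤,
    BurnsideRing.res ((⊤ : Subgroup S).subtype.comp φ) X = BurnsideRing.res P.subtype X}
  one_mem' P φ _ := by simp only [map_one]
  zero_mem' P φ _ := by simp only [map_zero]
  mul_mem' hX hY P φ hφ := by simp only [map_mul, hX P φ hφ, hY P φ hφ]
  add_mem' hX hY P φ hφ := by simp only [map_add, hX P φ hφ, hY P φ hφ]
  neg_mem' hX P φ hφ := by simp only [map_neg, hX P φ hφ]

/-- The `p`-localized Burnside ring `A(F)_(p)` as a subring of `A(S)_(p)`: the image of the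
(injective) map `A(F)_(p) → A(S)_(p)` induced by the inclusion `A(F) ⊆ A(S)`. -/
def pBurnside (p : ℕ) [Fact p.Prime] : Subring (PLocal p (BurnsideRing S)) :=
  (PLocal.map p F.burnside.subtype).range

end FusionSystem

end

/-! A finite `S`-set is determined by its fixed-point counts, so the marks are jointly injective on
`A(S)`, and also on `A(S)_(p)` after clearing denominators (`ext_pMark`). Uniqueness of `π(X)`
follows, and so do linearity and `π(Y) = Y` on stable elements, because the averaged marks have
these properties: marks of an `F`-stable element are constant on `F`-classes. The content is
existence.

After clearing denominators it suffices to find, for `X ∈ A(S)`, an integer `k` prime to `p` and a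
stable `Y` whose sum of marks over each `F`-class is `k` times that of `X` (`exists_mem_burnside`).
The classes are treated in order of decreasing subgroup order. At the class of a fully normalized
`P`, `X` is replaced by `k X + M`, where `M` is an integral combination of the sets `S/R` with `R ∈
[P]_F`. Three facts make this possible.

(1) The sum of the marks of `S/R` over an `F`-class depends only on the `F`-class of `R`
(`card_mul_sum_mark_coset`). Hence `M` changes no sum over any class as soon as its coefficients add
up to zero.

(2) If `X` is stable on all larger subgroups and `Q ∈ [P]_F`, then `|N_S(Q) : Q|` divides `Φ_Q(X) -
Φ_P(X)` (`card_normalizer_dvd`). Saturation extends a suitable isomorphism `Q → P` to `N_S(Q)`, and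
the Cauchy–Frobenius congruence is applied to the difference of the two restrictions of `X` to
`N_S(Q)`. This makes the coefficients of `M` integral.

(3) `|[P]_F|` and `|S : N_S(P)|` have the same `p`-part (`factorization_card_conjClass`), so the
factor `k` needed to equalize the marks integrally is prime to `p`. This is equivalent to the number
of morphisms `P → S` having the same `p`-part as `|S : C_S(P)|`. By induction the latter holds for
`N_S(P)`, hence for the morphisms that extend to `N_S(P)`; the others fall into `S × N_S(P)`-orbits
of length divisible by `p |S : C_S(P)|`. -/

/-! ### Marks separate the elements of a Burnside ring -/

namespace FinGSet

variable {G : Type u} [Group G]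

/-- The transitive `G`-set `G ⧸ P`. -/
noncomputable def coset [Finite G] (P : Subgroup G) : FinGSet G := ⟨G ⧸ P⟩

/-- The complement of the orbit of `x`. -/
def removeOrbit (X : FinGSet G) (x : X.carrier) : FinGSet G :=
  letI M : SubMulAction G X.carrier :=
    { carrier := (MulAction.orbit G x)ᶜ
      smul_mem' := fun g y hy h => hy (by
        rwa [MulAction.mem_orbit_symm, MulAction.orbit_smul, MulAction.mem_orbit_symm] at h) }
  ⟨M⟩

theorem card_removeOrbit_lt (X : FinGSet G) (x : X.carrier) :
    Nat.card (X.removeOrbit x).carrier < Nat.card X.carrier :=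
  Finite.card_subtype_lt (p := fun y => y ∈ (MulAction.orbit G x)ᶜ) (x := x)
    (fun h => h (MulAction.mem_orbit_self x))

theorem isIso_sum_removeOrbit [Finite G] (X : FinGSet G) (x : X.carrier) :
    IsIso ((coset (MulAction.stabilizer G x)).sum (X.removeOrbit x)) X := by
  classical
  refine ⟨(Equiv.sumCongr (MulAction.orbitEquivQuotientStabilizer G x).symm
    (Equiv.refl _)).trans (Equiv.Set.sumCompl (MulAction.orbit G x)), ?_⟩
  rintro g (y | y)
  · induction y using Quotient.inductionOn with
    | h a => exact mul_smul g a x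
  · rfl

end FinGSet

namespace FinGSetClass

variable {G : Type u} [Group G]

/-- The isomorphism class of a finite `G`-set. -/
abbrev mk (X : FinGSet G) : FinGSetClass G := Quotient.mk _ X

theorem mk_eq_coset_add [Finite G] (X : FinGSet G) (x : X.carrier) :
    mk X =
      mk (FinGSet.coset (MulAction.stabilizer G x)) + mk (X.removeOrbit x) :=
  (Quotient.sound (X.isIso_sum_removeOrbit x)).symm

theorem mark_mk (P : Subgroup G) (X : FinGSet G) :
    mark P (mk X) = Nat.card (MulAction.fixedPoints P X.carrier) := rfl

theorem mem_fixedPoints_iff_le_stabilizer {X : Type*} [MulAction G X] (P : Subgroup G) (x : X) :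
    x ∈ MulAction.fixedPoints P X ↔ P ≤ MulAction.stabilizer G x :=
  ⟨fun h g hg => h ⟨g, hg⟩, fun h g => h g.2⟩

theorem mark_ne_zero_iff (P : Subgroup G) (X : FinGSet G) :
    mark P (mk X) ≠ 0 ↔ ∃ x : X.carrier, P ≤ MulAction.stabilizer G x := by
  rw [mark_mk, Nat.card_ne_zero]
  simp only [and_iff_left (Subtype.finite : Finite (MulAction.fixedPoints P X.carrier))]
  constructor
  · rintro ⟨x, hx⟩
    exact ⟨x, (mem_fixedPoints_iff_le_stabilizer P x).1 hx⟩
  · rintro ⟨x, hx⟩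
    exact ⟨x, (mem_fixedPoints_iff_le_stabilizer P x).2 hx⟩

/-- Finite `G`-sets with the same numbers of fixed points are isomorphic. -/
theorem mk_eq_mk_of_mark_eq [Finite G] (X Y : FinGSet G)
    (h : ∀ P, mark P (mk X) = mark P (mk Y)) :
    mk X = mk Y := by
  induction hn : Nat.card X.carrier using Nat.strong_induction_on generalizing X Y with
  | _ n ih =>
  obtain hX | hX := isEmpty_or_nonempty X.carrier
  · have hY : IsEmpty Y.carrier := by
      by_contra hY
      obtain ⟨y⟩ := not_isEmpty_iff.1 hY
      obtain ⟨x, -⟩ := (mark_ne_zero_iff ⊥ X).1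
        (h ⊥ ▸ (mark_ne_zero_iff ⊥ Y).2 ⟨y, bot_le⟩)
      exact hX.elim x
    exact Quotient.sound ⟨Equiv.equivOfIsEmpty _ _, fun _ x => hX.elim x⟩
  -- For a stabilizer of maximal order, equality of marks gives `y` and `x'` with `G_x ≤ G_y ≤
  -- G_x'`, and maximality makes these equal. So both sets contain an orbit of type `G/G_x`, which
  -- can be removed.
  · obtain ⟨x, hx⟩ := Finite.exists_max
      fun x : X.carrier => Nat.card (MulAction.stabilizer G x)
    obtain ⟨y, hy⟩ := (mark_ne_zero_iff _ Y).1 (h (MulAction.stabilizer G x) ▸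
      (mark_ne_zero_iff _ X).2 ⟨x, le_rfl⟩)
    obtain ⟨x', hx'⟩ := (mark_ne_zero_iff _ X).1 ((h (MulAction.stabilizer G y)).symm ▸
      (mark_ne_zero_iff _ Y).2 ⟨y, le_rfl⟩)
    have hxy : MulAction.stabilizer G x = MulAction.stabilizer G y :=
      Subgroup.eq_of_le_of_card_ge hy ((Subgroup.card_le_of_le hx').trans (hx x'))
    rw [mk_eq_coset_add X x, mk_eq_coset_add Y y, hxy]
    congr 1
    refine ih _ (hn ▸ X.card_removeOrbit_lt x) _ _ (fun P => ?_) rfl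
    have := h P
    rw [mk_eq_coset_add X x, mk_eq_coset_add Y y, hxy, map_add, map_add] at this
    exact Nat.add_left_cancel this

/-- The Cauchy–Frobenius congruence for the action of `G` on the `P`-fixed points. -/
theorem card_dvd_sum_mark [Fintype G] (P : Subgroup G) [P.Normal] (x : FinGSetClass G) :
    Nat.card G ∣ ∑ g : G, mark (P ⊔ Subgroup.zpowers g) x := by
  induction x using Quotient.inductionOn with
  | h X =>
  have e : ∀ g : G, mark (P ⊔ Subgroup.zpowers g) (mk X) =
      Nat.card (MulAction.fixedBy (MulAction.fixedPoints P X.carrier) g) := by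
    intro g
    rw [mark_mk]
    refine Nat.card_congr
      { toFun := fun x => ⟨⟨x.1, ?_⟩, ?_⟩
        invFun := fun x => ⟨x.1.1, ?_⟩
        left_inv := fun _ => rfl
        right_inv := fun _ => rfl }
    · exact fun n => x.2 ⟨n, le_sup_left (a := P) n.2⟩
    · exact Subtype.ext (x.2 ⟨g, le_sup_right (a := P) (Subgroup.mem_zpowers g)⟩)
    · rw [mem_fixedPoints_iff_le_stabilizer, sup_le_iff, Subgroup.zpowers_le]
      exact ⟨(mem_fixedPoints_iff_le_stabilizer P _).1 x.1.2, congrArg Subtype.val x.2⟩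
  have hc := Nat.card_congr
    (MulAction.sigmaFixedByEquivOrbitsProdGroup G (MulAction.fixedPoints P X.carrier))
  rw [Nat.card_sigma, Nat.card_prod] at hc
  simp only [e, hc]
  exact dvd_mul_left _ _

theorem mark_res {H : Type u} [Group H] (f : H →* G) (P : Subgroup H) (x : FinGSetClass G) :
    mark P (res f x) = mark (P.map f) x := by
  induction x using Quotient.inductionOn with
  | h X =>
  refine Nat.card_congr (Equiv.subtypeEquivRight fun x => ⟨?_, ?_⟩)
  · rintro h ⟨_, n, hn, rfl⟩
    exact h ⟨n, hn⟩
  · intro h n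
    exact h ⟨f n, n, n.2, rfl⟩

end FinGSetClass

namespace BurnsideRing

variable {G : Type u} [Group G]

/-- The class of a finite `G`-set in the Burnside ring. -/
noncomputable def ofSet (X : FinGSet G) : BurnsideRing G :=
  GrothendieckRing.of (FinGSetClass.mk X)

theorem mark_of (P : Subgroup G) (x : FinGSetClass G) :
    mark P (GrothendieckRing.of x) = (FinGSetClass.mark P x : ℤ) :=
  GrothendieckRing.lift_of _ x

theorem res_of {H : Type u} [Group H] (f : H →* G) (x : FinGSetClass G) :
    res f (GrothendieckRing.of x) = GrothendieckRing.of (FinGSetClass.res f x) :=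
  GrothendieckRing.lift_of _ x

theorem exists_of_sub_of (X : BurnsideRing G) :
    ∃ a b : FinGSetClass G, X = GrothendieckRing.of a - GrothendieckRing.of b :=
  GrothendieckRing.exists_sub X

/-- The marks separate the elements of the Burnside ring. -/
theorem ext_mark [Finite G] {X Y : BurnsideRing G} (h : ∀ P, mark P X = mark P Y) : X = Y := by
  rw [← sub_eq_zero]
  obtain ⟨a, b, hab⟩ := exists_of_sub_of (X - Y)
  have hm : ∀ P, FinGSetClass.mark P a = FinGSetClass.mark P b := fun P => by
    have : mark P (X - Y) = 0 := by rw [map_sub, h, sub_self]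
    rw [hab, map_sub, mark_of, mark_of, sub_eq_zero] at this
    exact_mod_cast this
  rw [hab, sub_eq_zero]
  induction a using Quotient.inductionOn with
  | h A =>
  induction b using Quotient.inductionOn with
  | h B => exact congrArg _ (FinGSetClass.mk_eq_mk_of_mark_eq A B hm)

theorem mark_res {H : Type u} [Group H] (f : H →* G) (P : Subgroup H) (X : BurnsideRing G) :
    mark P (res f X) = mark (P.map f) X := by
  obtain ⟨a, b, rfl⟩ := exists_of_sub_of X
  simp only [map_sub, res_of, mark_of, FinGSetClass.mark_res]

/-- The summand depends only on the coset of `g` modulo `P`. Summing over `G` rather than `G/P`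
avoids the quotient group, at the cost of a factor `|P|` on both sides; that factor persists in the
later divisibilities. -/
theorem card_dvd_sum_mark [Fintype G] (P : Subgroup G) [P.Normal] (X : BurnsideRing G) :
    (Nat.card G : ℤ) ∣ ∑ g : G, mark (P ⊔ Subgroup.zpowers g) X := by
  obtain ⟨a, b, rfl⟩ := exists_of_sub_of X
  simp only [map_sub, mark_of, Finset.sum_sub_distrib]
  exact dvd_sub (mod_cast FinGSetClass.card_dvd_sum_mark P a)
    (mod_cast FinGSetClass.card_dvd_sum_mark P b)

variable (p : ℕ) [Fact p.Prime]

theorem pMark_algebraMap (P : Subgroup G) (X : BurnsideRing G) :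
    pMark p P (algebraMap _ _ X) = (mark P X : ℚ) := by
  simp [pMark]

/-- Every element of the localization has a multiple by an integer prime to `p` that comes from
the Burnside ring. -/
theorem exists_mul_eq_algebraMap {A : Type*} [CommRing A] (X : PLocal p A) :
    ∃ (n : ℤ) (Y : A), ¬ (p : ℤ) ∣ n ∧ (n : PLocal p A) * X = algebraMap _ _ Y := by
  obtain ⟨⟨Y, ⟨_, n, hn, rfl⟩⟩, h⟩ :=
    IsLocalization.surj (Algebra.algebraMapSubmonoid A (primeToP p)) X
  exact ⟨n, Y, hn, by simpa [mul_comm] using h⟩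

theorem isUnit_intCast {A : Type*} [CommRing A] {n : ℤ} (hn : ¬ (p : ℤ) ∣ n) :
    IsUnit (n : PLocal p A) := by
  have := IsLocalization.map_units (PLocal p A)
    (⟨algebraMap ℤ A n, n, hn, rfl⟩ : Algebra.algebraMapSubmonoid A (primeToP p))
  simpa using this

theorem ext_pMark [Finite G] {X Y : PLocal p (BurnsideRing G)}
    (h : ∀ P, pMark p P X = pMark p P Y) : X = Y := by
  rw [← sub_eq_zero]
  obtain ⟨n, Z, hn, hZ⟩ := exists_mul_eq_algebraMap p (X - Y)
  have : Z = 0 := ext_mark fun P => by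
    have := congrArg (pMark p P) hZ
    rw [map_mul, map_sub, h, sub_self, mul_zero, pMark_algebraMap] at this
    rw [map_zero]
    exact_mod_cast this.symm
  rw [this, map_zero] at hZ
  exact (isUnit_intCast p hn).mul_right_eq_zero.1 hZ

end BurnsideRing

/-! ### Morphisms of a fusion system, as homomorphisms to the ambient group -/

namespace FusionSystem

variable {S : Type u} [Group S] (F : FusionSystem S)

/-- `φ : P → S` is a morphism of `F`. -/
def IsMor {P : Subgroup S} (φ : P →* S) : Prop :=
  φ.codRestrict (⊤ : Subgroup S) (fun _ => trivial) ∈ F.hom P ⊤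

variable {F} {P Q R : Subgroup S}

theorem IsMor.of_mem_hom {φ : P →* Q} (h : φ ∈ F.hom P Q) : F.IsMor (Q.subtype.comp φ) := by
  have e : (Q.subtype.comp φ).codRestrict (⊤ : Subgroup S) (fun _ => trivial) =
      (conjHom Q ⊤ 1 fun _ _ => trivial).comp φ := by
    refine MonoidHom.ext fun x => Subtype.ext ?_
    change (φ x : S) = 1 * φ x * 1⁻¹
    simp
  rw [IsMor, e]
  exact F.comp_mem h (F.conj_mem _ _ _ _)

theorem IsMor.codRestrict_mem {φ : P →* S} (h : F.IsMor φ) (hQ : ∀ x, φ x ∈ Q) :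
    φ.codRestrict Q hQ ∈ F.hom P Q := by
  have hle : ∀ x ∈ homImage (φ.codRestrict (⊤ : Subgroup S) (fun _ => trivial)),
      (1 : S) * x * 1⁻¹ ∈ Q := by
    rintro _ ⟨x, rfl⟩
    change 1 * φ x * 1⁻¹ ∈ Q
    simpa using hQ x
  have e : φ.codRestrict Q hQ = (conjHom _ Q 1 hle).comp
      (toHomImage (φ.codRestrict (⊤ : Subgroup S) (fun _ => trivial))) := by
    refine MonoidHom.ext fun x => Subtype.ext ?_
    change φ x = 1 * φ x * 1⁻¹
    simp
  rw [e]
  exact F.comp_mem (F.toImage_mem h) (F.conj_mem _ _ _ _)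

theorem isMor_subtype_comp_iff {φ : P →* Q} : F.IsMor (Q.subtype.comp φ) ↔ φ ∈ F.hom P Q :=
  ⟨fun h => h.codRestrict_mem fun x => (φ x).2, IsMor.of_mem_hom⟩

theorem IsMor.injective {φ : P →* S} (h : F.IsMor φ) : Function.Injective φ := fun _ _ e =>
  F.injective h (Subtype.ext e)

theorem IsMor.comp {φ : P →* S} {ψ : Q →* S} (hψ : F.IsMor ψ) (hφ : F.IsMor φ)
    (hQ : ∀ x, φ x ∈ Q) : F.IsMor (ψ.comp (φ.codRestrict Q hQ)) :=
  F.comp_mem (hφ.codRestrict_mem hQ) hψ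

theorem isMor_conj (P : Subgroup S) (s : S) :
    F.IsMor ((MulAut.conj s).toMonoidHom.comp P.subtype) :=
  F.conj_mem P ⊤ s fun _ _ => trivial

theorem isMor_subtype (P : Subgroup S) : F.IsMor P.subtype := by
  have e : P.subtype = (MulAut.conj (1 : S)).toMonoidHom.comp P.subtype := by
    ext
    simp
  rw [e]
  exact isMor_conj P 1

theorem IsMor.restrict {φ : P →* S} (h : F.IsMor φ) (hQ : Q ≤ P) :
    F.IsMor (φ.comp (Subgroup.inclusion hQ)) :=
  h.comp (isMor_subtype Q) fun x => hQ x.2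

theorem IsMor.exists_inv {φ : P →* S} (h : F.IsMor φ) :
    ∃ ψ : φ.range →* S, F.IsMor ψ ∧ (∀ y, ψ y ∈ P) ∧ ∀ x, ψ ⟨φ x, x, rfl⟩ = x := by
  let m := MonoidHom.ofInjective (f := (⊤ : Subgroup S).subtype.comp
    (φ.codRestrict (⊤ : Subgroup S) (fun _ => trivial)))
    ((⊤ : Subgroup S).subtype_injective.comp (F.injective h))
  refine ⟨P.subtype.comp m.symm.toMonoidHom, IsMor.of_mem_hom (F.inv_mem h),
    fun y => (m.symm y).2, fun x => congrArg Subtype.val (m.symm_apply_apply x)⟩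

theorem IsMor.exists_apply_eq {φ : P →* S} {ψ : Q →* S} (hψ : F.IsMor ψ) (hφ : F.IsMor φ)
    (h : φ.range ≤ ψ.range) :
    ∃ α : P →* Q, α ∈ F.hom P Q ∧ ∀ x, ψ (α x) = φ x := by
  obtain ⟨χ, hχ, hQ, hχψ⟩ := hψ.exists_inv
  have hc := hχ.comp hφ fun x => h ⟨x, rfl⟩
  refine ⟨(χ.comp (φ.codRestrict ψ.range fun x => h ⟨x, rfl⟩)).codRestrict Q fun x => hQ _,
    hc.codRestrict_mem _, fun x => ?_⟩
  obtain ⟨y, hy⟩ := h ⟨x, rfl⟩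
  have hx : χ ⟨φ x, h ⟨x, rfl⟩⟩ = y := by
    rw [← hχψ]
    exact congrArg χ (Subtype.ext hy.symm)
  exact (congrArg ψ (Subtype.ext hx)).trans hy

theorem mem_aut_iff {α : MulAut P} : α ∈ F.aut P ↔ F.IsMor (P.subtype.comp α.toMonoidHom) :=
  isMor_subtype_comp_iff.symm

/-- Two morphisms with the same image differ by an automorphism. -/
theorem IsMor.exists_aut [Finite S] {φ ψ : P →* S} (hψ : F.IsMor ψ) (hφ : F.IsMor φ)
    (h : φ.range ≤ ψ.range) : ∃ α ∈ F.aut P, ∀ x, ψ (α x) = φ x := by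
  obtain ⟨α, hα, e⟩ := hψ.exists_apply_eq hφ h
  exact ⟨MulEquiv.ofBijective α (Finite.injective_iff_bijective.1 (F.injective hα)), hα, e⟩

theorem isConj_iff : F.IsConj P Q ↔ ∃ φ : P →* S, F.IsMor φ ∧ φ.range = Q := by
  constructor
  · rintro ⟨φ, hφ, hb⟩
    refine ⟨Q.subtype.comp φ, IsMor.of_mem_hom hφ, ?_⟩
    rw [MonoidHom.range_comp, MonoidHom.range_eq_top.2 hb.2, ← MonoidHom.range_eq_map,
      Subgroup.range_subtype]
  · rintro ⟨φ, hφ, rfl⟩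
    exact ⟨φ.rangeRestrict, hφ.codRestrict_mem (Q := φ.range) fun x => ⟨x, rfl⟩,
      fun _ _ e => hφ.injective (congrArg Subtype.val e), φ.rangeRestrict_surjective⟩

theorem IsMor.isConj {φ : P →* S} (h : F.IsMor φ) : F.IsConj P φ.range :=
  isConj_iff.2 ⟨φ, h, rfl⟩

theorem IsMor.isConj_map {φ : P →* S} (h : F.IsMor φ) (hQ : Q ≤ P) :
    F.IsConj Q ((Q.subgroupOf P).map φ) := by
  have := (h.restrict hQ).isConj
  rwa [MonoidHom.range_comp, Subgroup.inclusion_range] at this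

theorem IsConj.refl (P : Subgroup S) : F.IsConj P P :=
  isConj_iff.2 ⟨_, isMor_subtype P, P.range_subtype⟩

theorem IsConj.symm (h : F.IsConj P Q) : F.IsConj Q P := by
  obtain ⟨φ, hφ, rfl⟩ := isConj_iff.1 h
  obtain ⟨ψ, hψ, hP, e⟩ := hφ.exists_inv
  refine isConj_iff.2 ⟨ψ, hψ, le_antisymm ?_ fun x hx => ⟨_, e ⟨x, hx⟩⟩⟩
  rintro _ ⟨y, rfl⟩
  exact hP y

theorem IsConj.trans (h : F.IsConj P Q) (h' : F.IsConj Q R) : F.IsConj P R := by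
  obtain ⟨φ, hφ, hb⟩ := h
  obtain ⟨ψ, hψ, hb'⟩ := h'
  exact ⟨_, F.comp_mem hφ hψ, hb'.comp hb⟩

theorem IsConj.card_eq (h : F.IsConj P Q) : Nat.card P = Nat.card Q := by
  obtain ⟨φ, -, hb⟩ := h
  exact Nat.card_congr (Equiv.ofBijective φ hb)

theorem isConj_map_conj (P : Subgroup S) (s : S) :
    F.IsConj P (P.map (MulAut.conj s).toMonoidHom) := by
  have := (isMor_conj (F := F) P s).isConj
  rwa [MonoidHom.range_comp, Subgroup.range_subtype] at this

theorem mem_conjClass [Finite S] : Q ∈ F.conjClass P ↔ F.IsConj P Q := by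
  simp [conjClass]

theorem IsConj.conjClass_eq [Finite S] (h : F.IsConj P Q) : F.conjClass P = F.conjClass Q := by
  ext R
  rw [mem_conjClass, mem_conjClass]
  exact ⟨h.symm.trans, h.trans⟩

theorem FullyNormalized.of_isConj (hP : F.FullyNormalized P) (h : F.IsConj P Q)
    (hc : Nat.card (Subgroup.normalizer (P : Set S)) ≤
      Nat.card (Subgroup.normalizer (Q : Set S))) : F.FullyNormalized Q :=
  fun _ hR => (hP _ (h.trans hR)).trans hc

theorem exists_fullyNormalized [Finite S] (F : FusionSystem S) (P : Subgroup S) :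
    ∃ Q, F.IsConj P Q ∧ F.FullyNormalized Q := by
  obtain ⟨Q, hQ, hmax⟩ := (F.conjClass P).exists_max_image
    (fun Q => Nat.card (Subgroup.normalizer (Q : Set S))) ⟨P, mem_conjClass.2 (IsConj.refl P)⟩
  rw [mem_conjClass] at hQ
  exact ⟨Q, hQ, fun R hR => hmax R (mem_conjClass.2 (hQ.trans hR))⟩

theorem FullyCentralized.card_eq (hP : F.FullyCentralized P) (hQ : F.FullyCentralized Q)
    (h : F.IsConj P Q) : Nat.card (Subgroup.centralizer (P : Set S)) =
      Nat.card (Subgroup.centralizer (Q : Set S)) :=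
  le_antisymm (hQ _ h.symm) (hP _ h)

/-! ### Consequences of saturation -/

/-- The extension axiom with the condition `T ≤ N_φ` written out on elements: `φ` must carry the
action of each `t ∈ T` on `P` to conjugation by some `y ∈ S`. -/
theorem IsSaturated.exists_extension {p : ℕ} (hF : F.IsSaturated p) {T : Subgroup S} {φ : P →* S}
    (hφ : F.IsMor φ) (hc : F.FullyCentralized φ.range) (hPT : P ≤ T)
    (hT : T ≤ Subgroup.normalizer (P : Set S))
    (h : ∀ t ∈ T, ∃ y : S, ∀ g g' : P, (g' : S) = t * g * t⁻¹ → φ g' = y * φ g * y⁻¹) :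
    ∃ ψ : T →* S, F.IsMor ψ ∧ ∀ x (hx : x ∈ P), ψ ⟨x, hPT hx⟩ = φ ⟨x, hx⟩ := by
  obtain ⟨ψ, hψ, e⟩ := hF.extend P _ hφ hc
  have hle : T ≤ extender (φ.codRestrict (⊤ : Subgroup S) (fun _ => trivial)) :=
    fun t ht => ⟨hT ht, h t ht⟩
  exact ⟨_, (IsMor.of_mem_hom hψ).restrict hle, fun x hx =>
    congrArg Subtype.val (DFunLike.congr_fun e (⟨x, hx⟩ : P))⟩

theorem mem_autS_iff {α : MulAut P} :
    α ∈ autS P ↔ ∃ s : S, ∀ g, (α g : S) = s * g * s⁻¹ := by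
  constructor
  · rintro ⟨s, rfl⟩
    exact ⟨s, fun g => rfl⟩
  · rintro ⟨s, hs⟩
    have hn : s ∈ Subgroup.normalizer (P : Set S) := by
      refine Subgroup.mem_normalizer_iff.2 fun x => ⟨fun hx => ?_, fun hx => ?_⟩
      · rw [← hs ⟨x, hx⟩]
        exact (α _).2
      · have h := hs (α.symm ⟨_, hx⟩)
        rw [α.apply_symm_apply] at h
        have : x = (α.symm ⟨_, hx⟩ : P) := by simpa using h
        rw [this]
        exact (α.symm _).2
    exact ⟨⟨s, hn⟩, MulEquiv.ext fun g => Subtype.ext (hs g).symm⟩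

theorem autS_le_aut (P : Subgroup S) : autS P ≤ F.aut P := by
  intro α hα
  obtain ⟨s, hs⟩ := mem_autS_iff.1 hα
  rw [mem_aut_iff]
  have e : P.subtype.comp α.toMonoidHom = (MulAut.conj s).toMonoidHom.comp P.subtype :=
    MonoidHom.ext hs
  rw [e]
  exact isMor_conj P s

/-- `Aut_S(P) ≅ N_S(P)/C_S(P)`. -/
theorem card_autS_mul (P : Subgroup S) :
    Nat.card (autS P) * Nat.card (Subgroup.centralizer (P : Set S)) =
      Nat.card (Subgroup.normalizer (P : Set S)) := by
  have h := Subgroup.card_mul_index P.normalizerMonoidHom.ker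
  rw [Subgroup.index_ker, Subgroup.normalizerMonoidHom_ker,
    Nat.card_congr (Subgroup.subgroupOfEquivOfLe (Subgroup.centralizer_le_normalizer _)).toEquiv]
    at h
  rw [autS, mul_comm]
  exact h

theorem IsSaturated.factorization_card_aut {p : ℕ} [Fact p.Prime] [Finite S]
    (hF : F.IsSaturated p) (hP : F.FullyNormalized P) :
    Nat.card (autS P) = p ^ (Nat.card (F.aut P)).factorization p := by
  obtain ⟨T, hT⟩ := hF.sylow P hP
  rw [← T.card_eq_multiplicity]
  rw [hT]
  exact (Nat.card_congr (Subgroup.subgroupOfEquivOfLe (autS_le_aut P)).toEquiv).symm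

/-- A `p`-subgroup of `Aut_F(P)` is conjugate in `Aut_F(P)` to a group of conjugations. -/
theorem IsSaturated.exists_conj_le_autS {p : ℕ} [Fact p.Prime] [Finite S]
    (hF : F.IsSaturated p) (hP : F.FullyNormalized P) {K : Subgroup (MulAut P)}
    (hK : K ≤ F.aut P) (hpK : IsPGroup p K) :
    ∃ β ∈ F.aut P, ∀ κ ∈ K, β * κ * β⁻¹ ∈ autS P := by
  obtain ⟨T, hT⟩ := hF.sylow P hP
  obtain ⟨U, hU⟩ := (hpK.comap_of_injective (F.aut P).subtype
    (F.aut P).subtype_injective).exists_le_sylow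
  obtain ⟨b, hb⟩ := MulAction.exists_smul_eq (F.aut P) U T
  refine ⟨b, b.2, fun κ hκ => ?_⟩
  have h1 : (⟨κ, hK hκ⟩ : F.aut P) ∈ (U : Subgroup (F.aut P)) := hU hκ
  have h2 : b * ⟨κ, hK hκ⟩ * b⁻¹ ∈ (T : Subgroup (F.aut P)) := by
    rw [← hb]
    exact Subgroup.smul_mem_pointwise_smul _ (MulAut.conj b) _ h1
  rw [hT] at h2
  exact h2

end FusionSystem

/-! ### Counting lemmas -/

theorem Nat.card_eq_mul_of_card_fiber_eq {α β : Type*} [Finite α] [Finite β] (f : α → β) (k : ℕ)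
    (h : ∀ b, Nat.card {a // f a = b} = k) : Nat.card α = Nat.card β * k := by
  have := Fintype.ofFinite β
  rw [← Nat.card_congr (Equiv.sigmaFiberEquiv f), Nat.card_sigma]
  simp [h, Nat.card_eq_fintype_card]

/-- A sum of an invariant function is divisible by whatever divides the sums over the orbits. -/
theorem MulAction.dvd_sum_of_dvd_card_orbit_mul (G : Type*) {X : Type*} [Group G] [Fintype X]
    [MulAction G X] (h : X → ℤ) (hinv : ∀ (g : G) x, h (g • x) = h x) (D : ℤ)
    (hD : ∀ x, D ∣ Nat.card (MulAction.orbit G x) * h x) : D ∣ ∑ x, h x := by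
  classical
  have : Fintype (MulAction.orbitRel.Quotient G X) := Fintype.ofFinite _
  rw [← Finset.sum_fiberwise Finset.univ
    (fun x => (Quotient.mk'' x : MulAction.orbitRel.Quotient G X))]
  refine Finset.dvd_sum fun ω _ => ?_
  induction ω using Quotient.inductionOn' with
  | h y =>
  have e : ∀ x ∈ Finset.univ.filter
      (fun x => (Quotient.mk'' x : MulAction.orbitRel.Quotient G X) = Quotient.mk'' y),
      h x = h y := by
    intro x hx
    obtain ⟨g, rfl⟩ := MulAction.orbitRel_apply.1 (Quotient.exact' (Finset.mem_filter.1 hx).2)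
    exact hinv g y
  rw [Finset.sum_congr rfl e, Finset.sum_const, nsmul_eq_mul]
  have := Fintype.ofFinite (MulAction.orbit G y)
  have hD' := hD y
  rw [Nat.card_eq_fintype_card, Fintype.card_of_subtype (Finset.univ.filter
    (fun x => (Quotient.mk'' x : MulAction.orbitRel.Quotient G X) = Quotient.mk'' y))
    fun x => by rw [Finset.mem_filter, Quotient.eq'', MulAction.orbitRel_apply]; simp] at hD'
  exact hD'

theorem IsPGroup.card_dvd_of_card_le {p : ℕ} [Fact p.Prime] {G : Type*} [Group G] [Finite G]
    (hG : IsPGroup p G) {H K : Subgroup G} (h : Nat.card H ≤ Nat.card K) :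
    Nat.card H ∣ Nat.card K := by
  obtain ⟨m, hm⟩ := IsPGroup.iff_card.1 (hG.to_subgroup H)
  obtain ⟨n, hn⟩ := IsPGroup.iff_card.1 (hG.to_subgroup K)
  rw [hm, hn] at h ⊢
  exact pow_dvd_pow p ((Nat.pow_le_pow_iff_right (Fact.out : p.Prime).one_lt).1 h)

namespace FusionSystem

variable {S : Type u} [Group S] {F : FusionSystem S} {P Q R : Subgroup S}

/-! ### Morphisms of normalizers -/

theorem IsMor.congr_mem_aut {χ : Q →* S} (hχ : F.IsMor χ) {α : MulAut Q} (hα : α ∈ F.aut Q) :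
    MulAut.congr (MonoidHom.ofInjective hχ.injective) α ∈ F.aut χ.range := by
  obtain ⟨ψ, hψ, hQ, e⟩ := hχ.exists_inv
  have h := hχ.comp ((mem_aut_iff.1 hα).comp hψ hQ) fun x => (α _).2
  rw [mem_aut_iff]
  convert h using 1
  refine MonoidHom.ext fun y => ?_
  obtain ⟨x, rfl⟩ := (MonoidHom.ofInjective hχ.injective).surjective y
  have hx : (⟨ψ (MonoidHom.ofInjective hχ.injective x), hQ _⟩ : Q) = x := Subtype.ext (e x)
  change ((MonoidHom.ofInjective hχ.injective) (α ((MonoidHom.ofInjective hχ.injective).symm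
    (MonoidHom.ofInjective hχ.injective x))) : S) =
    χ (α ⟨ψ (MonoidHom.ofInjective hχ.injective x), hQ _⟩)
  rw [MulEquiv.symm_apply_apply, hx]
  rfl

theorem isPGroup_autS {p : ℕ} (hS : IsPGroup p S) (P : Subgroup S) : IsPGroup p (autS P) :=
  (hS.to_subgroup _).of_surjective _ P.normalizerMonoidHom.rangeRestrict_surjective

/-- If `P` is fully normalized, every conjugate `Q` of `P` is carried to `P` by a morphism defined
on the normalizer of `Q`. -/
theorem IsSaturated.exists_mor_normalizer {p : ℕ} [Fact p.Prime] [Finite S] (hS : IsPGroup p S)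
    (hF : F.IsSaturated p) (hP : F.FullyNormalized P) (hQ : F.IsConj Q P) :
    ∃ φ : Subgroup.normalizer (Q : Set S) →* S, F.IsMor φ ∧
      (Q.subgroupOf (Subgroup.normalizer (Q : Set S))).map φ = P := by
  obtain ⟨χ, hχ, rfl⟩ := isConj_iff.1 hQ
  let e := MonoidHom.ofInjective hχ.injective
  -- Transported along `χ`, `Aut_S(Q)` becomes a `p`-subgroup of `Aut_F(P)`; some `β` conjugates it
  -- into the Sylow subgroup `Aut_S(P)`. For `φ = β ∘ χ` this says exactly that `N_φ = N_S(Q)`.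
  obtain ⟨β, hβ, h⟩ := hF.exists_conj_le_autS hP
    (K := (autS Q).map (MulAut.congr e).toMonoidHom) (by
      rintro _ ⟨α, hα, rfl⟩
      exact hχ.congr_mem_aut (autS_le_aut Q hα)) ((isPGroup_autS hS Q).map _)
  let φ : Q →* S := (χ.range.subtype.comp β.toMonoidHom).comp e.toMonoidHom
  have hφ : F.IsMor φ := (mem_aut_iff.1 hβ).comp hχ fun x => ⟨x, rfl⟩
  have hr : φ.range = χ.range := by
    refine le_antisymm ?_ fun y hy => ?_
    · rintro _ ⟨x, rfl⟩
      exact (β (e x)).2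
    · refine ⟨e.symm (β.symm ⟨y, hy⟩), ?_⟩
      change ((β (e (e.symm (β.symm ⟨y, hy⟩))) : χ.range) : S) = y
      rw [e.apply_symm_apply, β.apply_symm_apply]
  obtain ⟨ψ, hψ, hext⟩ := hF.exists_extension hφ (hr ▸ hF.fullyCentralized _ hP)
    Subgroup.le_normalizer le_rfl (by
      intro t ht
      obtain ⟨s, hs⟩ := mem_autS_iff.1
        (h _ ⟨Q.normalizerMonoidHom ⟨t, ht⟩, ⟨_, rfl⟩, rfl⟩)
      refine ⟨s, fun g g' hg => ?_⟩
      have h1 := hs (β (e g))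
      have h2 : Q.normalizerMonoidHom ⟨t, ht⟩ g = g' := Subtype.ext hg.symm
      have h3 : (β * MulAut.congr e (Q.normalizerMonoidHom ⟨t, ht⟩) * β⁻¹) (β (e g)) =
          β (e g') := by
        change β (e (Q.normalizerMonoidHom ⟨t, ht⟩ (e.symm (β.symm (β (e g)))))) = _
        rw [β.symm_apply_apply, e.symm_apply_apply, h2]
      exact (congrArg Subtype.val h3).symm.trans h1)
  refine ⟨ψ, hψ, ?_⟩
  rw [← hr]
  ext y
  constructor
  · rintro ⟨x, hx, rfl⟩
    exact ⟨⟨x, hx⟩, (hext x hx).symm⟩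
  · rintro ⟨x, rfl⟩
    exact ⟨⟨x, Subgroup.le_normalizer x.2⟩, x.2, hext x x.2⟩

/-! ### The number of morphisms -/

variable (F) in
/-- The morphisms of `F` from `P` to `S`. -/
abbrev Mor (P : Subgroup S) : Type u := {φ : P →* S // F.IsMor φ}

instance [Finite S] (P : Subgroup S) : Finite (F.Mor P) :=
  haveI : Finite (P →* S) := DFunLike.finite _
  Subtype.finite

/-- Precomposition with an automorphism. -/
theorem IsMor.comp_aut {φ : P →* S} (hφ : F.IsMor φ) {α : MulAut P} (hα : α ∈ F.aut P) :
    F.IsMor (φ.comp α.toMonoidHom) :=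
  hφ.comp (mem_aut_iff.1 hα) fun x => (α x).2

/-- Postcomposition with a conjugation. -/
theorem IsMor.conj_comp {φ : P →* S} (hφ : F.IsMor φ) (s : S) :
    F.IsMor ((MulAut.conj s).toMonoidHom.comp φ) :=
  (isMor_conj φ.range s).comp hφ fun x => ⟨x, rfl⟩

/-- The possible images are the members of `[P]_F`, and `Aut_F(P)` acts simply transitively by
precomposition on the morphisms with a given image. -/
theorem card_mor_eq [Finite S] (P : Subgroup S) :
    Nat.card (F.Mor P) = (F.conjClass P).card * Nat.card (F.aut P) := by
  rw [← Fintype.card_coe, ← Nat.card_eq_fintype_card]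
  refine Nat.card_eq_mul_of_card_fiber_eq
    (fun φ : F.Mor P => (⟨φ.1.range, mem_conjClass.2 φ.2.isConj⟩ : F.conjClass P)) _ ?_
  rintro ⟨Q, hQ⟩
  obtain ⟨ψ, hψ, rfl⟩ := isConj_iff.1 (mem_conjClass.1 hQ)
  have hr : ∀ α : F.aut P, (ψ.comp (α : MulAut P).toMonoidHom).range = ψ.range := fun α => by
    rw [MonoidHom.range_comp, MonoidHom.range_eq_top.2 (α : MulAut P).surjective,
      MonoidHom.range_eq_map]
  refine (Nat.card_congr (Equiv.ofBijective (fun α : F.aut P =>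
    ⟨⟨ψ.comp (α : MulAut P).toMonoidHom, hψ.comp_aut α.2⟩, Subtype.ext (hr α)⟩) ⟨?_, ?_⟩)).symm
  · intro α β h
    refine Subtype.ext (MulEquiv.ext fun x => hψ.injective ?_)
    exact DFunLike.congr_fun (congrArg (fun z => z.1.1) h) x
  · rintro ⟨⟨φ, hφ⟩, h⟩
    obtain ⟨α, hα, e⟩ := hψ.exists_aut hφ (congrArg Subtype.val h).le
    exact ⟨⟨α, hα⟩, Subtype.ext (Subtype.ext (MonoidHom.ext e))⟩

variable (F) in
/-- The automorphisms of `T` in `F` that are the identity on `P`. -/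
def autFix (T P : Subgroup S) : Subgroup (MulAut T) where
  carrier := {α | α ∈ F.aut T ∧ ∀ x : T, (x : S) ∈ P → α x = x}
  one_mem' := ⟨one_mem _, fun _ _ => rfl⟩
  mul_mem' {α β} hα hβ := ⟨mul_mem hα.1 hβ.1, fun x hx => by
    rw [MulAut.mul_apply, hβ.2 x hx, hα.2 x hx]⟩
  inv_mem' {α} hα := ⟨Subgroup.inv_mem _ hα.1, fun x hx => by
    conv_lhs => rw [← hα.2 x hx]
    exact α.symm_apply_apply x⟩

end FusionSystem

/-! ### Extending morphisms from `P` to `N_S(P)` -/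

namespace FusionSystem

variable {S : Type u} [Group S] {F : FusionSystem S} {P Q R T : Subgroup S}

theorem range_le_normalizer_map (hT : T ≤ Subgroup.normalizer (P : Set S)) (ψ : T →* S) :
    ψ.range ≤ Subgroup.normalizer (((P.subgroupOf T).map ψ : Subgroup S) : Set S) := by
  rintro _ ⟨t, rfl⟩
  have key : ∀ (t : T) (y : S), y ∈ (P.subgroupOf T).map ψ →
      ψ t * y * (ψ t)⁻¹ ∈ (P.subgroupOf T).map ψ := by
    rintro t _ ⟨x, hx, rfl⟩
    exact ⟨t * x * t⁻¹, (Subgroup.mem_normalizer_iff.1 (hT t.2) _).1 hx, by simp⟩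
  refine Subgroup.mem_normalizer_iff.2 fun y => ⟨key t y, fun h => ?_⟩
  have := key t⁻¹ _ h
  simpa [mul_assoc] using this

/-- If `P` is fully normalized, a morphism on its normalizer maps onto the normalizer of the
image. -/
theorem FullyNormalized.normalizer_map [Finite S] (hP : F.FullyNormalized P)
    (hT : Subgroup.normalizer (P : Set S) = T) {ψ : T →* S} (hψ : F.IsMor ψ) :
    Subgroup.normalizer (((P.subgroupOf T).map ψ : Subgroup S) : Set S) = ψ.range := by
  have hPT : P ≤ T := hT ▸ Subgroup.le_normalizer
  refine (Subgroup.eq_of_le_of_card_ge (range_le_normalizer_map hT.ge ψ) ?_).symm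
  refine (hP _ (hψ.isConj_map hPT)).trans ?_
  rw [hT]
  exact hψ.isConj.card_eq.le

theorem FullyNormalized.map [Finite S] (hP : F.FullyNormalized P)
    (hT : Subgroup.normalizer (P : Set S) = T) {ψ : T →* S} (hψ : F.IsMor ψ) :
    F.FullyNormalized ((P.subgroupOf T).map ψ) := by
  have hPT : P ≤ T := hT ▸ Subgroup.le_normalizer
  refine hP.of_isConj (hψ.isConj_map hPT) ?_
  rw [hP.normalizer_map hT hψ, hT]
  exact hψ.isConj.card_eq.le

/-- The `p`-part of the number of automorphisms of `N_S(P)` that are the identity on `P`. -/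
theorem IsSaturated.card_autFix {p : ℕ} [Fact p.Prime] [Finite S] (hS : IsPGroup p S)
    (hF : F.IsSaturated p) (hP : F.FullyNormalized P)
    (hT : Subgroup.normalizer (P : Set S) = T) (hTn : F.FullyNormalized T) :
    p ^ (Nat.card (F.autFix T P)).factorization p *
      Nat.card (Subgroup.centralizer (T : Set S)) =
        Nat.card (Subgroup.centralizer (P : Set S)) := by
  have hPT : P ≤ T := hT ▸ Subgroup.le_normalizer
  let U : Sylow p (F.autFix T P) := default
  let K := (U : Subgroup (F.autFix T P)).map (F.autFix T P).subtype
  have hKfix : K ≤ F.autFix T P := Subgroup.map_subtype_le _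
  -- `K` is a Sylow `p`-subgroup of the automorphisms of `T` fixing `P`. Since `T` is fully
  -- normalized, `β` conjugates `K` into `Aut_S(T)`, where its elements become conjugations fixing
  -- `P' = β(P)` pointwise.
  obtain ⟨β, hβ, hβK⟩ := hF.exists_conj_le_autS hTn (K := K) (fun α hα => (hKfix hα).1)
    (U.2.map _)
  have hβm := mem_aut_iff.1 hβ
  have hr : (T.subtype.comp β.toMonoidHom).range = T := by
    rw [MonoidHom.range_comp, MonoidHom.range_eq_top.2 β.surjective, ← MonoidHom.range_eq_map,
      Subgroup.range_subtype]
  set P' := (P.subgroupOf T).map (T.subtype.comp β.toMonoidHom) with hP'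
  have hN : Subgroup.normalizer (P' : Set S) = T := (hP.normalizer_map hT hβm).trans hr
  have hcard := (hF.fullyCentralized _ hP).card_eq (hF.fullyCentralized _ (hP.map hT hβm))
    (hβm.isConj_map hPT)
  have hCT : Subgroup.centralizer (P' : Set S) ≤ T :=
    hN ▸ Subgroup.centralizer_le_normalizer _
  have hP'T : P' ≤ T := hN ▸ Subgroup.le_normalizer
  -- The image of `f` is `C_S(P')/C_S(T)`. Conjugated back by `β` it is a `p`-subgroup `B` of
  -- `autFix` containing `K`, hence of the same order as `K`; and `|C_S(P')| = |C_S(P)|` since both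
  -- subgroups are fully centralized.
  let f : Subgroup.centralizer (P' : Set S) →* MulAut T :=
    MulAut.conj.comp (Subgroup.inclusion hCT)
  have hker : f.ker = (Subgroup.centralizer (T : Set S)).subgroupOf _ := by
    ext x
    rw [MonoidHom.mem_ker, Subgroup.mem_subgroupOf, Subgroup.mem_centralizer_iff]
    constructor
    · intro h y hy
      have := congrArg Subtype.val (DFunLike.congr_fun h (⟨y, hy⟩ : T))
      change (x : S) * y * (x : S)⁻¹ = y at this
      rw [mul_inv_eq_iff_eq_mul] at this
      exact this.symm
    · intro h
      refine MulEquiv.ext fun y => Subtype.ext ?_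
      change (x : S) * y * (x : S)⁻¹ = y
      rw [mul_inv_eq_iff_eq_mul]
      exact (h y y.2).symm
  have hf : Nat.card f.range * Nat.card (Subgroup.centralizer (T : Set S)) =
      Nat.card (Subgroup.centralizer (P' : Set S)) := by
    have h := Subgroup.card_mul_index f.ker
    rwa [Subgroup.index_ker, hker, Nat.card_congr (Subgroup.subgroupOfEquivOfLe
      (Subgroup.centralizer_le hP'T)).toEquiv, mul_comm] at h
  let B := f.range.map (MulAut.conj β⁻¹).toMonoidHom
  have hBcard : Nat.card B = Nat.card f.range :=
    Subgroup.card_map_of_injective (MulAut.conj β⁻¹).injective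
  have hmem : ∀ x : T, (x : S) ∈ P → (β x : S) ∈ P' := fun x hx => ⟨x, hx, rfl⟩
  have hBfix : B ≤ F.autFix T P := by
    rintro _ ⟨_, ⟨s, rfl⟩, rfl⟩
    refine ⟨mul_mem (mul_mem (Subgroup.inv_mem _ hβ) (autS_le_aut T (mem_autS_iff.2
      ⟨s, fun _ => rfl⟩))) (Subgroup.inv_mem _ (Subgroup.inv_mem _ hβ)), fun x hx => ?_⟩
    change β.symm (f s (β x)) = x
    rw [MulEquiv.symm_apply_eq]
    refine Subtype.ext ?_
    change (s : S) * β x * (s : S)⁻¹ = β x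
    rw [mul_inv_eq_iff_eq_mul]
    exact (Subgroup.mem_centralizer_iff.1 s.2 _ (hmem x hx)).symm
  have hKB : K ≤ B := by
    intro κ hκ
    obtain ⟨s, hs⟩ := mem_autS_iff.1 (hβK κ hκ)
    have hsC : s ∈ Subgroup.centralizer (P' : Set S) := by
      rw [Subgroup.mem_centralizer_iff]
      rintro _ ⟨x, hx, rfl⟩
      have h := hs (β x)
      have hx' : (β * κ * β⁻¹) (β x) = β x := by
        change β (κ (β.symm (β x))) = β x
        rw [β.symm_apply_apply, (hKfix hκ).2 x hx]
      rw [hx', eq_mul_inv_iff_mul_eq] at h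
      exact h
    refine ⟨f ⟨s, hsC⟩, ⟨_, rfl⟩, ?_⟩
    have e : f ⟨s, hsC⟩ = β * κ * β⁻¹ := MulEquiv.ext fun y => Subtype.ext (hs y).symm
    change β⁻¹ * f ⟨s, hsC⟩ * (β⁻¹)⁻¹ = κ
    rw [e]
    group
  have hKcard : Nat.card K = p ^ (Nat.card (F.autFix T P)).factorization p := by
    rw [← U.card_eq_multiplicity]
    exact Subgroup.card_map_of_injective (F.autFix T P).subtype_injective
  have hBp : IsPGroup p B :=
    ((hS.to_subgroup _).of_surjective _ f.rangeRestrict_surjective).map _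
  obtain ⟨n, hn⟩ := IsPGroup.iff_card.1 hBp
  have hle : n ≤ (Nat.card (F.autFix T P)).factorization p :=
    ((Fact.out : p.Prime).pow_dvd_iff_le_factorization Nat.card_pos.ne').1
      (hn ▸ Subgroup.card_dvd_of_le hBfix)
  have hpB : p ^ (Nat.card (F.autFix T P)).factorization p = Nat.card B :=
    le_antisymm (hKcard ▸ Subgroup.card_le_of_le hKB)
      (hn ▸ Nat.pow_le_pow_right (Fact.out : p.Prime).pos hle)
  rw [hpB, hBcard, hf, hcard]

variable (F) in
/-- The morphisms from `P` to `S` that extend to `T`. -/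
def extendable (T P : Subgroup S) : Set (F.Mor P) :=
  {φ | ∃ ψ : F.Mor T, ∀ (x : S) (hx : x ∈ P) (hx' : x ∈ T), ψ.1 ⟨x, hx'⟩ = φ.1 ⟨x, hx⟩}

/-- Restrict to `P`. Two extensions `T → S` of the same `φ` have the same image, namely `N_S(φ(P))`,
because `P` is fully normalized; so they differ by an automorphism of `T` that is the identity on
`P`. -/
theorem card_mor_normalizer [Finite S] (hP : F.FullyNormalized P)
    (hT : Subgroup.normalizer (P : Set S) = T) :
    Nat.card (F.Mor T) = Nat.card (F.extendable T P) * Nat.card (F.autFix T P) := by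
  have hPT : P ≤ T := hT ▸ Subgroup.le_normalizer
  refine Nat.card_eq_mul_of_card_fiber_eq (fun ψ : F.Mor T =>
    (⟨⟨ψ.1.comp (Subgroup.inclusion hPT), ψ.2.restrict hPT⟩, ψ, fun _ _ _ => rfl⟩ :
      F.extendable T P)) _ ?_
  rintro ⟨⟨φ, hφ⟩, ψ, hψ⟩
  have hr : ∀ (α : F.autFix T P) (x : P), ψ.1 ((α : MulAut T) ⟨x, hPT x.2⟩) = φ x := by
    intro α x
    rw [α.2.2 _ x.2]
    exact hψ x x.2 _
  refine (Nat.card_congr (Equiv.ofBijective (fun α : F.autFix T P =>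
    ⟨⟨ψ.1.comp (α : MulAut T).toMonoidHom, ψ.2.comp_aut α.2.1⟩,
      Subtype.ext (Subtype.ext (MonoidHom.ext (hr α)))⟩) ⟨?_, ?_⟩)).symm
  · intro α β h
    refine Subtype.ext (MulEquiv.ext fun x => ψ.2.injective ?_)
    exact DFunLike.congr_fun (congrArg (fun z => z.1.1) h) x
  · rintro ⟨⟨χ, hχ⟩, h⟩
    have hχψ : ∀ x (hx : x ∈ P), χ ⟨x, hPT hx⟩ = ψ.1 ⟨x, hPT hx⟩ := fun x hx =>
      (DFunLike.congr_fun (congrArg (fun z => z.1.1) h) (⟨x, hx⟩ : P)).trans (hψ x hx _).symm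
    have hmap : (P.subgroupOf T).map χ = (P.subgroupOf T).map ψ.1 := by
      ext y
      constructor
      · rintro ⟨x, hx, rfl⟩
        exact ⟨x, hx, (hχψ x hx).symm⟩
      · rintro ⟨x, hx, rfl⟩
        exact ⟨x, hx, hχψ x hx⟩
    obtain ⟨α, hα, e⟩ := ψ.2.exists_aut hχ (by
      rw [← hP.normalizer_map hT hχ, ← hP.normalizer_map hT ψ.2, hmap])
    refine ⟨⟨α, hα, fun x hx => ψ.2.injective ?_⟩, Subtype.ext (Subtype.ext (MonoidHom.ext e))⟩
    rw [e]
    exact hχψ x hx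

/-- `S × N_S(P)` acts on the morphisms from `P` to `S` by conjugation on both sides. -/
instance morAction (F : FusionSystem S) (P : Subgroup S) :
    MulAction (S × Subgroup.normalizer (P : Set S)) (F.Mor P) where
  smul g φ := ⟨(MulAut.conj g.1).toMonoidHom.comp
    (φ.1.comp (P.normalizerMonoidHom g.2⁻¹).toMonoidHom),
    (φ.2.comp_aut (autS_le_aut P ⟨_, rfl⟩)).conj_comp g.1⟩
  one_smul φ := Subtype.ext (MonoidHom.ext fun x => by
    change (1 : S) * φ.1 (P.normalizerMonoidHom (1 : Subgroup.normalizer (P : Set S))⁻¹ x) * 1⁻¹ = _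
    simp)
  mul_smul g h φ := Subtype.ext (MonoidHom.ext fun x => by
    change (g.1 * h.1) * φ.1 (P.normalizerMonoidHom (g.2 * h.2)⁻¹ x) * (g.1 * h.1)⁻¹ =
      g.1 * (h.1 * φ.1 (P.normalizerMonoidHom h.2⁻¹ (P.normalizerMonoidHom g.2⁻¹ x)) * h.1⁻¹) *
        g.1⁻¹
    rw [mul_inv_rev g.2, map_mul, MulAut.mul_apply]
    group)

theorem mor_smul_apply (g : S × Subgroup.normalizer (P : Set S)) (φ : F.Mor P) (x : P) :
    (g • φ).1 x = g.1 * φ.1 (P.normalizerMonoidHom g.2⁻¹ x) * g.1⁻¹ := rfl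

theorem mem_stabilizer_mor_iff (g : S × Subgroup.normalizer (P : Set S)) (φ : F.Mor P) :
    g ∈ MulAction.stabilizer _ φ ↔
      ∀ x : P, φ.1 (P.normalizerMonoidHom g.2 x) = g.1 * φ.1 x * g.1⁻¹ := by
  rw [MulAction.mem_stabilizer_iff]
  constructor
  · intro h x
    conv_lhs => rw [← h]
    rw [mor_smul_apply, map_inv, MulAut.inv_apply_self]
  · intro h
    refine Subtype.ext (MonoidHom.ext fun x => ?_)
    rw [mor_smul_apply, ← h, map_inv, MulAut.apply_inv_self]

/-- The elements of `N_S(P)` whose action on `P` is carried by `φ` to a conjugation. -/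
def stabilizerSnd (φ : F.Mor P) :
    MulAction.stabilizer (S × Subgroup.normalizer (P : Set S)) φ →*
      Subgroup.normalizer (P : Set S) :=
  (MonoidHom.snd _ _).comp (Subgroup.subtype _)

/-- The projection of the stabilizer to `N_S(P)` has image `N_φ` and kernel `C_S(φ(P))`. -/
theorem card_stabilizer_mor [Finite S] (φ : F.Mor P) :
    Nat.card (MulAction.stabilizer (S × Subgroup.normalizer (P : Set S)) φ) =
      Nat.card (stabilizerSnd φ).range *
        Nat.card (Subgroup.centralizer (φ.1.range : Set S)) := by
  rw [← Subgroup.card_mul_index (stabilizerSnd φ).ker, Subgroup.index_ker, mul_comm]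
  congr 1
  have hiff : ∀ s : S, ((s, 1) : S × Subgroup.normalizer (P : Set S)) ∈
      MulAction.stabilizer _ φ ↔ s ∈ Subgroup.centralizer (φ.1.range : Set S) := by
    intro s
    rw [mem_stabilizer_mor_iff, Subgroup.mem_centralizer_iff]
    simp only [map_one, MulAut.one_apply, eq_mul_inv_iff_mul_eq]
    exact ⟨by rintro h _ ⟨x, rfl⟩; exact h x, fun h x => h _ ⟨x, rfl⟩⟩
  have hfst : ∀ z : (stabilizerSnd φ).ker, ((z.1.1.1, 1) :
      S × Subgroup.normalizer (P : Set S)) ∈ MulAction.stabilizer _ φ := by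
    rintro ⟨⟨⟨s, t⟩, h⟩, h1⟩
    obtain rfl : t = 1 := h1
    exact h
  refine Nat.card_congr
    { toFun := fun z => ⟨z.1.1.1, (hiff _).1 (hfst z)⟩
      invFun := fun s => ⟨⟨(s.1, 1), (hiff _).2 s.2⟩, rfl⟩
      left_inv := ?_
      right_inv := fun _ => rfl }
  rintro ⟨⟨⟨s, t⟩, h⟩, h1⟩
  obtain rfl : t = 1 := h1
  rfl

end FusionSystem

/-! ### Orbits of non-extendable morphisms and the `p`-part of `|[P]_F|` -/

namespace FusionSystem

variable {S : Type u} [Group S] {F : FusionSystem S} {P Q R T : Subgroup S}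

theorem smul_mem_extendable (g : S × Subgroup.normalizer (P : Set S)) {φ : F.Mor P}
    (h : φ ∈ F.extendable (Subgroup.normalizer (P : Set S)) P) :
    g • φ ∈ F.extendable (Subgroup.normalizer (P : Set S)) P := by
  obtain ⟨ψ, hψ⟩ := h
  refine ⟨⟨_, (ψ.2.comp_aut (α := MulAut.conj g.2⁻¹)
    (autS_le_aut _ (mem_autS_iff.2 ⟨(g.2⁻¹ : Subgroup.normalizer (P : Set S)),
      fun _ => rfl⟩))).conj_comp g.1⟩, fun x hx hx' => ?_⟩
  have := hψ (P.normalizerMonoidHom g.2⁻¹ ⟨x, hx⟩ : P) (Subtype.property _)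
    (Subgroup.le_normalizer (Subtype.property _))
  rw [mor_smul_apply]
  change g.1 * ψ.1 _ * g.1⁻¹ = _
  rw [← this]
  rfl

/-- The first equality says `N_φ = N_S(P)`, the second that `φ(P)` is fully centralized, so the
extension axiom applies. -/
theorem IsSaturated.mem_extendable {p : ℕ} [Finite S] (hF : F.IsSaturated p)
    (hP : F.FullyNormalized P) {φ : F.Mor P}
    (hr : Nat.card (stabilizerSnd φ).range = Nat.card (Subgroup.normalizer (P : Set S)))
    (hc : Nat.card (Subgroup.centralizer (φ.1.range : Set S)) =
      Nat.card (Subgroup.centralizer (P : Set S))) :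
    φ ∈ F.extendable (Subgroup.normalizer (P : Set S)) P := by
  have htop : (stabilizerSnd φ).range = ⊤ := Subgroup.eq_top_of_card_eq _ hr
  obtain ⟨ψ, hψ, h⟩ := hF.exists_extension φ.2
    (fun R hR => hc ▸ hF.fullyCentralized P hP R (φ.2.isConj.trans hR))
    Subgroup.le_normalizer le_rfl (by
      intro t ht
      obtain ⟨⟨⟨s, t'⟩, hst⟩, h⟩ : (⟨t, ht⟩ : Subgroup.normalizer (P : Set S)) ∈
        (stabilizerSnd φ).range := htop ▸ Subgroup.mem_top _
      obtain rfl : t' = ⟨t, ht⟩ := h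
      refine ⟨s, fun g g' hg => ?_⟩
      rw [← (mem_stabilizer_mor_iff _ φ).1 hst g]
      exact congrArg φ.1 (Subtype.ext hg))
  exact ⟨⟨ψ, hψ⟩, fun x hx _ => h x hx⟩

/-- The stabilizer has order `|N_φ| |C_S(φ(P))|`, with factors at most `|N_S(P)|` and `|C_S(P)|`. If
`φ` does not extend, one of the two is strictly smaller, and since all orders are powers of `p` the
orbit length gains a factor `p` over `|S : C_S(P)|`. -/
theorem IsSaturated.dvd_card_orbit {p : ℕ} [Fact p.Prime] [Finite S] (hS : IsPGroup p S)
    (hF : F.IsSaturated p) (hP : F.FullyNormalized P) {φ : F.Mor P}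
    (hφ : φ ∉ F.extendable (Subgroup.normalizer (P : Set S)) P) :
    p * (Subgroup.centralizer (P : Set S)).index ∣
      Nat.card (MulAction.orbit (S × Subgroup.normalizer (P : Set S)) φ) := by
  have hp : p.Prime := Fact.out
  have hN := hS.to_subgroup (Subgroup.normalizer (P : Set S))
  obtain ⟨a, ha⟩ := IsPGroup.iff_card.1 (hN.to_subgroup (stabilizerSnd φ).range)
  obtain ⟨b, hb⟩ := IsPGroup.iff_card.1
    (hS.to_subgroup (Subgroup.centralizer (φ.1.range : Set S)))
  obtain ⟨d, hd⟩ := IsPGroup.iff_card.1 hN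
  obtain ⟨e, he⟩ := IsPGroup.iff_card.1 (hS.to_subgroup (Subgroup.centralizer (P : Set S)))
  have had : a ≤ d := (Nat.pow_le_pow_iff_right hp.one_lt).1
    (ha ▸ hd ▸ Subgroup.card_le_card_group _)
  have hbe : b ≤ e := (Nat.pow_le_pow_iff_right hp.one_lt).1
    (hb ▸ he ▸ hF.fullyCentralized P hP _ φ.2.isConj)
  have hlt : a + b < d + e := by
    by_contra hge
    exact hφ (hF.mem_extendable hP (by rw [ha, hd, show a = d by omega])
      (by rw [hb, he, show b = e by omega]))
  obtain ⟨j, hj⟩ := pow_dvd_pow p (show a + b + 1 ≤ d + e from hlt)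
  have h1 : Nat.card (MulAction.orbit (S × Subgroup.normalizer (P : Set S)) φ) * p ^ (a + b) =
      Nat.card S * p ^ d := by
    rw [pow_add, ← ha, ← hb, ← card_stabilizer_mor, ← hd, ← Nat.card_prod, ← Nat.card_prod]
    exact Nat.card_congr (MulAction.orbitProdStabilizerEquivGroup _ φ)
  have h2 := Subgroup.card_mul_index (Subgroup.centralizer (P : Set S))
  refine ⟨j, Nat.eq_of_mul_eq_mul_right (pow_pos hp.pos (a + b)) ?_⟩
  rw [h1, ← h2, he]
  calc p ^ e * (Subgroup.centralizer (P : Set S)).index * p ^ d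
      = (Subgroup.centralizer (P : Set S)).index * p ^ (d + e) := by ring
    _ = p * (Subgroup.centralizer (P : Set S)).index * j * p ^ (a + b) := by rw [hj]; ring

theorem IsSaturated.card_mor_modEq {p : ℕ} [Fact p.Prime] [Finite S] (hS : IsPGroup p S)
    (hF : F.IsSaturated p) (hP : F.FullyNormalized P) :
    (p * (Subgroup.centralizer (P : Set S)).index : ℤ) ∣ Nat.card (F.Mor P) -
      Nat.card (F.extendable (Subgroup.normalizer (P : Set S)) P) := by
  classical
  have := Fintype.ofFinite (F.Mor P)
  set E := F.extendable (Subgroup.normalizer (P : Set S)) P with hE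
  have hinv : ∀ (g : S × Subgroup.normalizer (P : Set S)) (φ : F.Mor P), g • φ ∈ E ↔ φ ∈ E :=
    fun g φ => ⟨fun h => inv_smul_smul g φ ▸ smul_mem_extendable g⁻¹ h, smul_mem_extendable g⟩
  have h := MulAction.dvd_sum_of_dvd_card_orbit_mul (S × Subgroup.normalizer (P : Set S))
    (fun φ : F.Mor P => if φ ∈ E then (0 : ℤ) else 1) (fun g φ => by simp only [hinv])
    (p * (Subgroup.centralizer (P : Set S)).index : ℕ) (fun φ => by
      by_cases hφ : φ ∈ E
      · simp [hφ]
      · rw [if_neg hφ, mul_one, Int.natCast_dvd_natCast]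
        exact hF.dvd_card_orbit hS hP hφ)
  have hsum : ∑ φ : F.Mor P, (if φ ∈ E then (0 : ℤ) else 1) =
      Nat.card (F.Mor P) - Nat.card E := by
    have e : ∀ φ : F.Mor P, (if φ ∈ E then (0 : ℤ) else 1) = 1 - if φ ∈ E then 1 else 0 := by
      intro φ
      split_ifs <;> rfl
    simp only [e, Finset.sum_sub_distrib, Nat.card_eq_fintype_card]
    simp [Fintype.card_subtype]
  rw [hsum] at h
  exact_mod_cast h

theorem card_conjClass_pos [Finite S] (P : Subgroup S) : 0 < (F.conjClass P).card :=
  Finset.card_pos.2 ⟨P, mem_conjClass.2 (IsConj.refl P)⟩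

theorem card_mor_pos [Finite S] (P : Subgroup S) : 0 < Nat.card (F.Mor P) :=
  haveI : Nonempty (F.Mor P) := ⟨⟨_, isMor_subtype P⟩⟩
  Nat.card_pos

/-- Since `Aut_S(P) ≅ N_S(P)/C_S(P)` is Sylow in `Aut_F(P)`, statements about the `p`-part of
`|[P]_F|` translate into statements about the number of morphisms. -/
theorem IsSaturated.factorization_card_mor_add {p : ℕ} [Fact p.Prime] [Finite S]
    (hF : F.IsSaturated p) (hP : F.FullyNormalized P) :
    (Nat.card (F.Mor P)).factorization p +
      (Nat.card (Subgroup.centralizer (P : Set S))).factorization p =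
    (F.conjClass P).card.factorization p +
      (Nat.card (Subgroup.normalizer (P : Set S))).factorization p := by
  have hp : p.Prime := Fact.out
  rw [card_mor_eq, Nat.factorization_mul (card_conjClass_pos P).ne' Nat.card_pos.ne',
    ← card_autS_mul, hF.factorization_card_aut hP,
    Nat.factorization_mul (pow_pos hp.pos _).ne' Nat.card_pos.ne', hp.factorization_pow]
  simp [add_assoc]

/-- A congruence modulo `p ^ (k + 1)` preserves the property of having `p`-adic valuation exactly
`k`. -/
theorem factorization_eq_of_dvd_sub {p m n i : ℕ} (hp : p.Prime) (hm : m ≠ 0) (hn : n ≠ 0)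
    (hni : n.factorization p = i.factorization p)
    (hip : i = p ^ i.factorization p) (h : (p * i : ℤ) ∣ m - n) :
    m.factorization p = n.factorization p := by
  set k := i.factorization p
  have hpk : ∀ j ≤ k + 1, p ^ j ∣ m ↔ p ^ j ∣ n := fun j hj => by
    have h1 : ((p ^ j : ℕ) : ℤ) ∣ m - n :=
      (show ((p ^ j : ℕ) : ℤ) ∣ p * i by
        rw [hip]; exact_mod_cast (pow_dvd_pow p hj).trans (pow_succ' p k).dvd).trans h
    rw [← Int.natCast_dvd_natCast, ← Int.natCast_dvd_natCast]
    exact (dvd_iff_dvd_of_dvd_sub h1)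
  simp only [hp.pow_dvd_iff_le_factorization hm, hp.pow_dvd_iff_le_factorization hn] at hpk
  have h1 := hpk k (by omega)
  have h2 := hpk (k + 1) le_rfl
  omega

/-- The `p`-part of the number of conjugates of a fully normalized subgroup. -/
theorem IsSaturated.factorization_card_conjClass {p : ℕ} [Fact p.Prime] [Finite S]
    (hS : IsPGroup p S) (hF : F.IsSaturated p) (hP : F.FullyNormalized P) :
    (F.conjClass P).card.factorization p +
      (Nat.card (Subgroup.normalizer (P : Set S))).factorization p =
    (Nat.card S).factorization p := by
  have hp : p.Prime := Fact.out
  induction hn : Nat.card S - Nat.card P using Nat.strong_induction_on generalizing P with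
  | _ n ih =>
  obtain rfl | htop := eq_or_ne P ⊤
  · have h1 : F.conjClass ⊤ = {⊤} := by
      ext Q
      rw [mem_conjClass, Finset.mem_singleton]
      constructor
      · intro h
        exact Subgroup.eq_top_of_card_eq _ (by rw [← h.card_eq, Subgroup.card_top])
      · rintro rfl
        exact IsConj.refl _
    rw [h1, Subgroup.normalizer_eq_top]
    simp
  · have hnil : Group.IsNilpotent S := hS.isNilpotent
    have hlt := Group.normalizerCondition_of_isNilpotent P htop.lt_top
    -- Moving `P` along `ψ` keeps it fully normalized and carries its normalizer to the fully
    -- normalized `T`. The claim only involves the class of `P` and the order of its normalizer, so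
    -- it may be proved for `P'`.
    obtain ⟨T, hT, hTn⟩ := F.exists_fullyNormalized (Subgroup.normalizer (P : Set S))
    obtain ⟨ψ, hψ, rfl⟩ := isConj_iff.1 hT
    set P' := (P.subgroupOf (Subgroup.normalizer (P : Set S))).map ψ
    have hPP' : F.IsConj P P' := hψ.isConj_map Subgroup.le_normalizer
    have hP' : F.FullyNormalized P' := hP.map rfl hψ
    have hN : Subgroup.normalizer (P' : Set S) = ψ.range := hP.normalizer_map rfl hψ
    have hNc : Nat.card (Subgroup.normalizer (P' : Set S)) =
        Nat.card (Subgroup.normalizer (P : Set S)) := le_antisymm (hP _ hPP') (hP' _ hPP'.symm)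
    have hPlt : Nat.card P < Nat.card (Subgroup.normalizer (P : Set S)) :=
      lt_of_not_ge fun h => hlt.ne (Subgroup.eq_of_le_of_card_ge hlt.le h)
    rw [hPP'.conjClass_eq, ← hNc, ← hF.factorization_card_mor_add hP']
    rw [← hN] at hTn
    have hT' := ih _ (by
      have := Subgroup.card_le_card_group (Subgroup.normalizer (P : Set S))
      omega) hTn rfl
    rw [← hF.factorization_card_mor_add hTn, card_mor_normalizer hP' rfl] at hT'
    have hfix := congrArg (fun n => n.factorization p) (hF.card_autFix hS hP' rfl hTn)
    have hE : Nat.card (F.extendable (Subgroup.normalizer (P' : Set S)) P') ≠ 0 := by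
      have := (card_mor_pos (F := F) (Subgroup.normalizer (P' : Set S))).ne'
      rw [card_mor_normalizer hP' rfl] at this
      exact left_ne_zero_of_mul this
    simp only [Nat.factorization_mul (pow_pos hp.pos _).ne' Nat.card_pos.ne',
      hp.factorization_pow, Finsupp.add_apply, Finsupp.single_eq_same] at hfix
    rw [Nat.factorization_mul hE Nat.card_pos.ne', Finsupp.add_apply] at hT'
    have hidx := congrArg (fun n => n.factorization p)
      (Subgroup.card_mul_index (Subgroup.centralizer (P' : Set S)))
    simp only [Nat.factorization_mul Nat.card_pos.ne' Subgroup.index_ne_zero_of_finite,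
      Finsupp.add_apply] at hidx
    obtain ⟨k, hk⟩ := hS.index (Subgroup.centralizer (P' : Set S))
    -- The induction hypothesis for `N_S(P')`, divided by the `p`-part of `autFix`, shows that the
    -- number of extendable morphisms has the `p`-part of `|S : C_S(P')|`.
    have hv := factorization_eq_of_dvd_sub hp (card_mor_pos P').ne' hE
      (i := (Subgroup.centralizer (P' : Set S)).index)
      (by omega) (by rw [hk, hp.factorization_pow]; simp) (hF.card_mor_modEq hS hP')
    omega

end FusionSystem

/-! ### The marks of transitive sets -/

namespace BurnsideRing

variable {G : Type u} [Group G]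

theorem mark_map_conj (Q : Subgroup G) (s : G) (X : BurnsideRing G) :
    mark (Q.map (MulAut.conj s).toMonoidHom) X = mark Q X := by
  obtain ⟨a, b, rfl⟩ := exists_of_sub_of X
  have key : ∀ a : FinGSetClass G, FinGSetClass.mark (Q.map (MulAut.conj s).toMonoidHom) a =
      FinGSetClass.mark Q a := by
    intro a
    induction a using Quotient.inductionOn with
    | h X =>
    refine (Nat.card_congr ((MulAction.toPerm s).subtypeEquiv fun x => ?_)).symm
    constructor
    · rintro h ⟨_, q, hq, rfl⟩
      have := h ⟨q, hq⟩
      change q • x = x at this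
      change (s * q * s⁻¹) • s • x = s • x
      rw [← mul_smul, inv_mul_cancel_right, mul_smul, this]
    · rintro h ⟨q, hq⟩
      have := h ⟨s * q * s⁻¹, q, hq, rfl⟩
      change (s * q * s⁻¹) • s • x = s • x at this
      rw [← mul_smul, inv_mul_cancel_right, mul_smul] at this
      exact MulAction.injective s this
  simp only [map_sub, mark_of, key]

theorem card_map_conj (P : Subgroup G) (s : G) :
    Nat.card (P.map (MulAut.conj s).toMonoidHom) = Nat.card P :=
  Subgroup.card_map_of_injective (MulAut.conj s).injective

variable [Finite G]

/-- The coset `sP` is fixed by `Q` iff `Q ≤ sPs⁻¹`, and each coset has `|P|` representatives. -/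
theorem card_mul_mark_coset (P Q : Subgroup G) :
    (Nat.card P : ℤ) * mark Q (ofSet (FinGSet.coset P)) =
      Nat.card {s : G // Q ≤ P.map (MulAut.conj s).toMonoidHom} := by
  rw [ofSet, mark_of, FinGSetClass.mark_mk]
  norm_cast
  rw [← Nat.card_prod]
  refine (Nat.card_congr (QuotientGroup.preimageMkEquivSubgroupProdSet P
    (MulAction.fixedPoints Q (G ⧸ P)))).symm.trans
    (Nat.card_congr (Equiv.subtypeEquivRight fun s => ?_))
  have h : ∀ q : G, q • (s : G ⧸ P) = s ↔ q ∈ P.map (MulAut.conj s).toMonoidHom := by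
    intro q
    rw [Subgroup.mem_map_equiv, MulAction.Quotient.smul_coe, eq_comm, QuotientGroup.eq,
      MulAut.conj_symm_apply, smul_eq_mul, mul_assoc]
  constructor
  · intro hs q hq
    exact (h q).1 (hs ⟨q, hq⟩)
  · rintro hs ⟨q, hq⟩
    exact (h q).2 (hs hq)

theorem exists_le_map_conj_of_mark_coset_ne_zero {P Q : Subgroup G}
    (h : mark Q (ofSet (FinGSet.coset P)) ≠ 0) :
    ∃ s, Q ≤ P.map (MulAut.conj s).toMonoidHom := by
  have h1 := card_mul_mark_coset P Q
  have h2 : Nat.card {s : G // Q ≤ P.map (MulAut.conj s).toMonoidHom} ≠ 0 := by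
    intro h0
    rw [h0, Nat.cast_zero, mul_eq_zero] at h1
    exact h1.elim (by exact_mod_cast Nat.card_pos.ne') h
  obtain ⟨⟨s, hs⟩⟩ := (Nat.card_ne_zero.1 h2).1
  exact ⟨s, hs⟩

theorem card_mul_mark_coset_self (P : Subgroup G) :
    (Nat.card P : ℤ) * mark P (ofSet (FinGSet.coset P)) =
      Nat.card (Subgroup.normalizer (P : Set G)) := by
  rw [card_mul_mark_coset]
  norm_cast
  refine Nat.card_congr (Equiv.subtypeEquivRight fun s => ?_)
  rw [Subgroup.mem_normalizer_iff_map_conj_eq]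
  constructor
  · intro h
    exact (Subgroup.eq_of_le_of_card_ge h (card_map_conj P s).le).symm
  · intro h
    exact h.ge

end BurnsideRing

/-! ### Sums of marks over `F`-classes and the correction terms -/

namespace FusionSystem

open BurnsideRing

variable {S : Type u} [Group S] {F : FusionSystem S} {P Q R T : Subgroup S} [Finite S]

variable (F) in
/-- The conjugates of `Q` that are contained in `P`. -/
noncomputable def conjIn (Q P : Subgroup S) : ℕ := Nat.card {R // F.IsConj Q R ∧ R ≤ P}

theorem conjIn_le_of_isConj (h : F.IsConj P R) : F.conjIn Q P ≤ F.conjIn Q R := by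
  obtain ⟨φ, hφ, rfl⟩ := isConj_iff.1 h
  refine Nat.card_le_card_of_injective
    (fun T : {R // F.IsConj Q R ∧ R ≤ P} => (⟨(T.1.subgroupOf P).map φ,
      T.2.1.trans (hφ.isConj_map T.2.2), Subgroup.map_le_range _ _⟩ :
        {R // F.IsConj Q R ∧ R ≤ φ.range})) ?_
  rintro ⟨T, hT⟩ ⟨T', hT'⟩ h
  have h' := Subgroup.map_injective hφ.injective (congrArg Subtype.val h)
  rw [Subgroup.subgroupOf_inj, inf_eq_left.2 hT.2, inf_eq_left.2 hT'.2] at h'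
  exact Subtype.ext h'

theorem conjIn_eq_of_isConj (h : F.IsConj P R) : F.conjIn Q P = F.conjIn Q R :=
  le_antisymm (conjIn_le_of_isConj h) (conjIn_le_of_isConj h.symm)

theorem conjIn_self (P : Subgroup S) : F.conjIn P P = 1 := by
  rw [conjIn, Nat.card_eq_one_iff_unique]
  refine ⟨⟨fun T T' => Subtype.ext ?_⟩, ⟨P, IsConj.refl P, le_rfl⟩⟩
  rw [Subgroup.eq_of_le_of_card_ge T.2.2 T.2.1.card_eq.le,
    Subgroup.eq_of_le_of_card_ge T'.2.2 T'.2.1.card_eq.le]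

/-- Count pairs `(Q', s)` with `Q' ∈ [Q]_F` and `Q' ≤ sPs⁻¹` by `s` first: each `s` contributes
`conjIn Q P`. As `conjIn Q P` depends only on the `F`-class of `P`, so does the sum. -/
theorem card_mul_sum_mark_coset (P Q : Subgroup S) :
    (Nat.card P : ℤ) * ∑ Q' ∈ F.conjClass Q, mark Q' (ofSet (FinGSet.coset P)) =
      Nat.card S * F.conjIn Q P := by
  have := Fintype.ofFinite S
  rw [Finset.mul_sum]
  simp only [card_mul_mark_coset]
  norm_cast
  rw [← Finset.sum_coe_sort, ← Nat.card_sigma]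
  have e : (Σ Q' : F.conjClass Q, {s : S // (Q' : Subgroup S) ≤ P.map (MulAut.conj s).toMonoidHom})
      ≃ Σ s : S, {R // F.IsConj Q R ∧ R ≤ P.map (MulAut.conj s).toMonoidHom} :=
    { toFun := fun z => ⟨z.2.1, z.1.1, mem_conjClass.1 z.1.2, z.2.2⟩
      invFun := fun z => ⟨⟨z.2.1, mem_conjClass.2 z.2.2.1⟩, z.1, z.2.2.2⟩
      left_inv := fun _ => rfl
      right_inv := fun _ => rfl }
  rw [Nat.card_congr e, Nat.card_sigma]
  have h : ∀ s : S, Nat.card {R // F.IsConj Q R ∧ R ≤ P.map (MulAut.conj s).toMonoidHom} =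
      F.conjIn Q P := fun s => (conjIn_eq_of_isConj (isConj_map_conj P s)).symm
  rw [Finset.sum_congr rfl fun s _ => h s]
  simp [Nat.card_eq_fintype_card]

/-- `S` acts on a conjugacy class of subgroups by conjugation. -/
instance conjClassAction (F : FusionSystem S) (P : Subgroup S) :
    MulAction S (F.conjClass P) where
  smul s Q := ⟨Q.1.map (MulAut.conj s).toMonoidHom,
    mem_conjClass.2 ((mem_conjClass.1 Q.2).trans (isConj_map_conj _ s))⟩
  one_smul Q := Subtype.ext (by
    change Q.1.map (MulAut.conj 1).toMonoidHom = Q.1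
    rw [map_one]
    exact Subgroup.map_id _)
  mul_smul s t Q := Subtype.ext (by
    change Q.1.map (MulAut.conj (s * t)).toMonoidHom =
      (Q.1.map (MulAut.conj t).toMonoidHom).map (MulAut.conj s).toMonoidHom
    rw [map_mul, Subgroup.map_map]
    rfl)

theorem coe_smul_conjClass (s : S) (Q : F.conjClass P) :
    ((s • Q : F.conjClass P) : Subgroup S) = Q.1.map (MulAut.conj s).toMonoidHom := rfl

theorem card_orbit_conjClass_mul (Q : F.conjClass P) :
    Nat.card (MulAction.orbit S Q) * Nat.card (Subgroup.normalizer (Q.1 : Set S)) =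
      Nat.card S := by
  have h : MulAction.stabilizer S Q = Subgroup.normalizer (Q.1 : Set S) := by
    ext s
    rw [MulAction.mem_stabilizer_iff, Subgroup.mem_normalizer_iff_map_conj_eq, Subtype.ext_iff]
    rfl
  rw [← h, ← Nat.card_prod]
  exact Nat.card_congr (MulAction.orbitProdStabilizerEquivGroup S Q)

/-- An element of the Burnside ring with prescribed marks on a conjugacy class, whose marks sum to
zero over every conjugacy class. -/
theorem exists_mark_eq_of_sum_eq_zero (P : Subgroup S) (g : F.conjClass P → ℤ)
    (hg : ∀ (s : S) Q, g (s • Q) = g Q)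
    (hdvd : ∀ Q : F.conjClass P,
      (Nat.card (Subgroup.normalizer (Q.1 : Set S)) : ℤ) ∣ Nat.card P * g Q)
    (hsum : ∑ Q, g Q = 0) :
    ∃ M : BurnsideRing S, (∀ Q : F.conjClass P, mark Q.1 M = g Q) ∧
      (∀ Q, ¬ F.IsConj P Q → Nat.card P ≤ Nat.card Q → mark Q M = 0) ∧
      ∀ Q, ∑ Q' ∈ F.conjClass Q, mark Q' M = 0 := by
  classical
  have := Fintype.ofFinite (MulAction.orbitRel.Quotient S (F.conjClass P))
  have hPpos : (Nat.card P : ℤ) ≠ 0 := by exact_mod_cast Nat.card_pos.ne'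
  have hc : ∀ Q : F.conjClass P, Nat.card Q.1 = Nat.card P := fun Q =>
    (mem_conjClass.1 Q.2).card_eq.symm
  -- `l Q = g Q / |N_S(Q) : Q|` is the coefficient that gives `l Q • [S/Q]` the mark `g Q` at `Q`.
  choose l hl using hdvd
  let r : MulAction.orbitRel.Quotient S (F.conjClass P) → F.conjClass P := Quotient.out
  let M : BurnsideRing S := ∑ ω, l (r ω) • ofSet (FinGSet.coset (r ω).1)
  have hM : ∀ Q, mark Q M = ∑ ω, l (r ω) * mark Q (ofSet (FinGSet.coset (r ω).1)) := fun Q => by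
    simp only [M, map_sum, map_zsmul, smul_eq_mul]
  -- A subgroup of order at least `|P|` has a fixed point on `S/R`, for `R ∈ [P]_F`, only if it is
  -- `S`-conjugate to `R`. So one representative per `S`-orbit suffices, without interference
  -- between orbits.
  have hconj : ∀ (Q : Subgroup S) (ω), Nat.card P ≤ Nat.card Q →
      mark Q (ofSet (FinGSet.coset (r ω).1)) ≠ 0 → ∃ s : S, Q = (s • r ω).1 := by
    intro Q ω hQ h
    obtain ⟨s, hs⟩ := exists_le_map_conj_of_mark_coset_ne_zero h
    exact ⟨s, Subgroup.eq_of_le_of_card_ge hs ((card_map_conj _ s).trans_le ((hc _).trans_le hQ))⟩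
  have h1 : ∀ Q : F.conjClass P, mark Q.1 M = g Q := by
    intro Q
    obtain ⟨s, hs⟩ : Q ∈ MulAction.orbit S (r (Quotient.mk'' Q)) :=
      MulAction.orbitRel_apply.1 (Quotient.exact' (Quotient.out_eq' _).symm)
    rw [hM, Finset.sum_eq_single (Quotient.mk'' Q)]
    · generalize r (Quotient.mk'' Q) = Q₀ at hs
      subst hs
      have h2 := card_mul_mark_coset_self Q₀.1
      rw [hc] at h2
      refine mul_left_cancel₀ hPpos ?_
      rw [hg, hl, ← h2]
      change _ * (_ * mark (Q₀.1.map (MulAut.conj s).toMonoidHom) _) = _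
      rw [mark_map_conj]
      ring
    · intro ω _ hω
      by_contra hne
      obtain ⟨t, ht⟩ := hconj Q.1 ω (hc Q).ge (right_ne_zero_of_mul hne)
      refine hω ?_
      rw [← Quotient.out_eq' ω]
      exact Quotient.sound' (MulAction.orbitRel_apply.2
        (MulAction.mem_orbit_symm.1 ⟨t, (Subtype.ext ht).symm⟩))
    · exact fun h => absurd (Finset.mem_univ _) h
  have h3 : ∀ Q, (Nat.card P : ℤ) * ∑ Q' ∈ F.conjClass Q, mark Q' M =
      (∑ ω, l (r ω)) * (Nat.card S * F.conjIn Q P) := by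
    intro Q
    simp only [hM]
    rw [Finset.sum_comm, Finset.mul_sum, Finset.sum_mul]
    refine Finset.sum_congr rfl fun ω _ => ?_
    rw [← Finset.mul_sum, conjIn_eq_of_isConj (mem_conjClass.1 (r ω).2),
      ← card_mul_sum_mark_coset, hc]
    ring
  -- At the class of `P` itself the sum of marks is a nonzero multiple of the sum of the
  -- coefficients, so the latter vanishes; by `h3` the sums over all other classes vanish too.
  have h4 : ∑ ω, l (r ω) = 0 := by
    have := h3 P
    rw [← Finset.sum_coe_sort, Finset.sum_congr rfl fun Q _ => h1 Q, hsum, mul_zero, conjIn_self,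
      Nat.cast_one, mul_one, eq_comm, mul_eq_zero] at this
    exact this.resolve_right (by exact_mod_cast Nat.card_pos.ne')
  refine ⟨M, h1, fun Q hQ hQc => ?_, fun Q => ?_⟩
  · rw [hM]
    refine Finset.sum_eq_zero fun ω _ => ?_
    by_contra hne
    obtain ⟨t, rfl⟩ := hconj Q ω hQc (right_ne_zero_of_mul hne)
    exact hQ (mem_conjClass.1 (t • r ω).2)
  · have := h3 Q
    rw [h4, zero_mul] at this
    exact (mul_eq_zero.1 this).resolve_left hPpos

end FusionSystem

/-! ### Congruences for marks and stabilization class by class -/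

namespace FusionSystem

open BurnsideRing

variable {S : Type u} [Group S] {F : FusionSystem S} {P Q R T : Subgroup S}

variable (F) in
/-- The marks of `X` are constant on the conjugacy class of `Q`. -/
def StableAt (X : BurnsideRing S) (Q : Subgroup S) : Prop :=
  ∀ Q', F.IsConj Q Q' → mark Q' X = mark Q X

theorem StableAt.of_isConj {X : BurnsideRing S} (h : F.StableAt X P) (hPQ : F.IsConj P Q) :
    F.StableAt X Q := fun R hR => (h R (hPQ.trans hR)).trans (h Q hPQ).symm

variable [Finite S]

/-- Stability is detected by the marks. -/
theorem mem_burnside_iff {X : BurnsideRing S} : X ∈ F.burnside ↔ ∀ Q, F.StableAt X Q := by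
  constructor
  · intro h Q Q' hQ
    obtain ⟨φ, hφ, rfl⟩ := isConj_iff.1 hQ
    have := congrArg (mark ⊤) (h Q _ hφ)
    rw [mark_res, mark_res, ← MonoidHom.range_eq_map, ← MonoidHom.range_eq_map,
      Subgroup.range_subtype] at this
    exact this
  · intro h P φ hφ
    refine ext_mark fun Q => ?_
    rw [mark_res, mark_res]
    have h1 := (IsMor.of_mem_hom hφ).isConj_map (Subgroup.map_subtype_le Q)
    rw [← Subgroup.comap_subtype, Subgroup.comap_map_eq_self_of_injective
      P.subtype_injective] at h1
    exact h _ _ h1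

/-- If `X` is stable on the subgroups larger than `P`, its marks on the conjugates of `P` satisfy
a congruence. -/
theorem IsSaturated.card_normalizer_dvd {p : ℕ} [Fact p.Prime] (hS : IsPGroup p S)
    (hF : F.IsSaturated p) (hP : F.FullyNormalized P) {X : BurnsideRing S}
    (hX : ∀ Q : Subgroup S, Nat.card P < Nat.card Q → F.StableAt X Q) (hQ : F.IsConj Q P) :
    (Nat.card (Subgroup.normalizer (Q : Set S)) : ℤ) ∣
      Nat.card P * (mark Q X - mark P X) := by
  classical
  have := Fintype.ofFinite (Subgroup.normalizer (Q : Set S))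
  obtain ⟨φ, hφ, hφQ⟩ := hF.exists_mor_normalizer hS hP hQ
  generalize hN : Subgroup.normalizer (Q : Set S) = N at *
  have hQN : Q ≤ N := hN ▸ Subgroup.le_normalizer
  have hnorm : (Q.subgroupOf N).Normal := hN ▸ Subgroup.normal_in_normalizer
  have hmap : (Q.subgroupOf N).map N.subtype = Q := Subgroup.map_subgroupOf_eq_of_le hQN
  have hd := card_dvd_sum_mark (Q.subgroupOf N) (res N.subtype X - res φ X)
  -- For `n ∉ Q` the join is strictly larger than `Q`, and `φ` carries it to an `F`-conjugate, on
  -- which `X` has the same mark. Only the `|Q| = |P|` elements of `Q` contribute.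
  have hval : ∀ n : N, mark (Q.subgroupOf N ⊔ Subgroup.zpowers n)
      (res N.subtype X - res φ X) = if n ∈ Q.subgroupOf N then mark Q X - mark P X else 0 := by
    intro n
    rw [map_sub, mark_res, mark_res]
    split_ifs with hn
    · rw [sup_eq_left.2 (Subgroup.zpowers_le.2 hn), hmap, hφQ]
    · set R := Q.subgroupOf N ⊔ Subgroup.zpowers n
      have hlt : Q.subgroupOf N < R := left_lt_sup.2 fun h => hn (Subgroup.zpowers_le.1 h)
      have hR : Nat.card P < Nat.card (R.map N.subtype) := by
        rw [← hQ.card_eq, Subgroup.card_map_of_injective N.subtype_injective, ← hmap,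
          Subgroup.card_map_of_injective N.subtype_injective]
        exact lt_of_not_ge fun h => hlt.ne (Subgroup.eq_of_le_of_card_ge hlt.le h)
      have h1 := hφ.isConj_map (Subgroup.map_subtype_le R)
      rw [← Subgroup.comap_subtype, Subgroup.comap_map_eq_self_of_injective
        N.subtype_injective] at h1
      rw [hX _ hR _ h1, sub_self]
  rw [Finset.sum_congr rfl fun n _ => hval n, ← Finset.sum_filter, Finset.sum_const,
    nsmul_eq_mul, ← Fintype.card_subtype, ← Nat.card_eq_fintype_card] at hd
  have hcard : Nat.card {n : N // n ∈ Q.subgroupOf N} = Nat.card P :=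
    (Nat.card_congr (Subgroup.subgroupOfEquivOfLe hQN).toEquiv).trans hQ.card_eq
  rwa [hcard] at hd

variable (F) in
/-- `Y` has, up to the factor `k`, the same sums of marks over conjugacy classes as `X`. -/
def SameSums (k : ℕ) (X Y : BurnsideRing S) : Prop :=
  ∀ Q, ∑ Q' ∈ F.conjClass Q, mark Q' Y = k * ∑ Q' ∈ F.conjClass Q, mark Q' X

/-- An element that is stable on the subgroups larger than `P` can be made stable at `P`, without
changing the averages of its marks over conjugacy classes, up to a factor prime to `p`. -/
theorem IsSaturated.exists_stableAt {p : ℕ} [Fact p.Prime] (hS : IsPGroup p S)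
    (hF : F.IsSaturated p) (P : Subgroup S) (X : BurnsideRing S)
    (hX : ∀ Q : Subgroup S, Nat.card P < Nat.card Q → F.StableAt X Q) :
    ∃ (k : ℕ) (Y : BurnsideRing S), ¬ p ∣ k ∧ F.StableAt Y P ∧
      (∀ Q, ¬ F.IsConj P Q → Nat.card P ≤ Nat.card Q → mark Q Y = k * mark Q X) ∧
      F.SameSums k X Y := by
  have hp : p.Prime := Fact.out
  obtain ⟨P₀, hP₀, hn⟩ := F.exists_fullyNormalized P
  -- Everything depends only on the `F`-class of `P`, so `P` may be taken fully normalized.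
  suffices h : ∃ (k : ℕ) (Y : BurnsideRing S), ¬ p ∣ k ∧ F.StableAt Y P₀ ∧
      (∀ Q, ¬ F.IsConj P₀ Q → Nat.card P₀ ≤ Nat.card Q → mark Q Y = k * mark Q X) ∧
      F.SameSums k X Y by
    obtain ⟨k, Y, hk, hY, h1, h2⟩ := h
    exact ⟨k, Y, hk, hY.of_isConj hP₀.symm, fun Q hQ hc =>
      h1 Q (fun h => hQ (hP₀.trans h)) (hP₀.card_eq ▸ hc), h2⟩
  rw [hP₀.card_eq] at hX
  clear hP₀ P
  rename' P₀ => P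
  set N := Subgroup.normalizer (P : Set S) with hN
  obtain ⟨k, hk, hkc⟩ : ∃ k, ¬ p ∣ k ∧ (F.conjClass P).card = k * N.index := by
    have h1 := hF.factorization_card_conjClass hS hn
    rw [← hN, ← Subgroup.card_mul_index N, Nat.factorization_mul Nat.card_pos.ne'
      Subgroup.index_ne_zero_of_finite, Finsupp.add_apply] at h1
    obtain ⟨j, hj⟩ := hS.index N
    have h2 : N.index = p ^ (F.conjClass P).card.factorization p := by
      rw [hj, hp.factorization_pow, Finsupp.single_eq_same] at h1
      rw [hj, show (F.conjClass P).card.factorization p = j by omega]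
    refine ⟨_, Nat.not_dvd_ordCompl hp (card_conjClass_pos (F := F) P).ne', ?_⟩
    rw [h2, mul_comm]
    exact (Nat.ordProj_mul_ordCompl_eq_self _ p).symm
  have hPpos : (Nat.card P : ℤ) ≠ 0 := by exact_mod_cast Nat.card_pos.ne'
  obtain ⟨w, hw⟩ : Nat.card P ∣ Nat.card N := Subgroup.card_dvd_of_le Subgroup.le_normalizer
  let D : F.conjClass P → ℤ := fun Q => mark Q.1 X - mark P X
  have hD : ∀ Q : F.conjClass P,
      (Nat.card (Subgroup.normalizer (Q.1 : Set S)) : ℤ) ∣ Nat.card P * D Q := fun Q =>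
    hF.card_normalizer_dvd hS hn hX (mem_conjClass.1 Q.2).symm
  have hDinv : ∀ (s : S) Q, D (s • Q) = D Q := fun s Q => by
    simp only [D, coe_smul_conjClass, mark_map_conj]
  -- The `S`-orbit of `Q` has `|S : N_S(Q)|` members, and each contributes a multiple of `|N_S(Q)|`.
  obtain ⟨m, hm⟩ : (Nat.card S : ℤ) ∣ ∑ Q, Nat.card P * D Q := by
    refine MulAction.dvd_sum_of_dvd_card_orbit_mul S _ (fun s Q => by rw [hDinv]) _ fun Q => ?_
    rw [← card_orbit_conjClass_mul Q, Nat.cast_mul]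
    exact mul_dvd_mul_left _ (hD Q)
  rw [← Finset.mul_sum] at hm
  have hS' : (Nat.card S : ℤ) = Nat.card P * w * N.index := by
    rw [← Subgroup.card_mul_index N, hw]
    push_cast
    ring
  -- The common new mark on `[P]_F` is to be `k Φ_P(X) + w m`, with `w = |N_S(P) : P|`. The constant
  -- `w m` is forced by preservation of the sum: `|[P]_F| w m = k |S : N_S(P)| w m = k ∑ D`.
  -- Integrality holds because `|P| w = |N_S(P)|` is divisible by `|N_S(Q)|`.
  obtain ⟨M, hM1, hM2, hM3⟩ := exists_mark_eq_of_sum_eq_zero P (fun Q => w * m - k * D Q)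
    (fun s Q => by rw [hDinv]) (fun Q => by
      have h1 : (Nat.card (Subgroup.normalizer (Q.1 : Set S)) : ℤ) ∣ Nat.card P * w := by
        rw [← Nat.cast_mul, ← hw, Int.natCast_dvd_natCast]
        exact hS.card_dvd_of_card_le (hn _ (mem_conjClass.1 Q.2))
      have h2 : (Nat.card P : ℤ) * (w * m - k * D Q) =
          Nat.card P * w * m - k * (Nat.card P * D Q) := by ring
      rw [h2]
      exact dvd_sub (h1.mul_right _) ((hD Q).mul_left _)) (by
    rw [Finset.sum_sub_distrib, ← Finset.mul_sum Finset.univ D, Finset.sum_const, Finset.card_univ,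
      Fintype.card_coe, hkc]
    refine mul_left_cancel₀ hPpos ?_
    rw [mul_sub, mul_left_comm _ (k : ℤ), hm, hS']
    simp only [nsmul_eq_mul]
    push_cast
    ring)
  have hmark : ∀ Q, mark Q ((k : BurnsideRing S) * X + M) = k * mark Q X + mark Q M := fun Q => by
    rw [map_add, map_mul, map_natCast]
  have hval : ∀ Q, F.IsConj P Q →
      mark Q ((k : BurnsideRing S) * X + M) = k * mark P X + w * m := fun Q hQ => by
    rw [hmark, hM1 ⟨Q, mem_conjClass.2 hQ⟩]
    ring
  refine ⟨k, (k : BurnsideRing S) * X + M, hk, fun Q hQ => ?_, fun Q hQ hc => ?_, fun Q => ?_⟩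
  · rw [hval Q hQ, hval P (IsConj.refl P)]
  · rw [hmark, hM2 Q hQ hc, add_zero]
  · simp only [hmark]
    rw [Finset.sum_add_distrib, hM3, add_zero, Finset.mul_sum]

theorem SameSums.trans {k l : ℕ} {X Y Z : BurnsideRing S} (h : F.SameSums k X Y)
    (h' : F.SameSums l Y Z) : F.SameSums (l * k) X Z := fun Q => by
  rw [h' Q, h Q]
  push_cast
  ring

/-- Subgroups of order `n` are handled one at a time. A correction at `P` multiplies the marks at
all non-conjugate subgroups of order at least `n` by one constant, so stability already achieved is
kept. -/
theorem IsSaturated.exists_stableAt_card {p : ℕ} [Fact p.Prime] (hS : IsPGroup p S)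
    (hF : F.IsSaturated p) (n : ℕ) (X : BurnsideRing S)
    (hX : ∀ Q : Subgroup S, n < Nat.card Q → F.StableAt X Q) :
    ∃ (k : ℕ) (Y : BurnsideRing S), ¬ p ∣ k ∧ F.SameSums k X Y ∧
      ∀ Q : Subgroup S, n ≤ Nat.card Q → F.StableAt Y Q := by
  classical
  have hp : p.Prime := Fact.out
  have := Fintype.ofFinite (Subgroup S)
  suffices h : ∀ s : Finset (Subgroup S), (∀ P ∈ s, Nat.card P = n) →
      ∃ (k : ℕ) (Y : BurnsideRing S), ¬ p ∣ k ∧ F.SameSums k X Y ∧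
        (∀ Q : Subgroup S, n < Nat.card Q → F.StableAt Y Q) ∧ ∀ Q ∈ s, F.StableAt Y Q by
    obtain ⟨k, Y, hk, h1, h2, h3⟩ := h (Finset.univ.filter fun P => Nat.card P = n) (by simp)
    refine ⟨k, Y, hk, h1, fun Q hQ => ?_⟩
    obtain hlt | heq := hQ.lt_or_eq
    · exact h2 Q hlt
    · exact h3 Q (by simp [heq])
  intro s
  induction s using Finset.induction_on with
  | empty => exact fun _ => ⟨1, X, hp.not_dvd_one, fun Q => by simp, hX, by simp⟩
  | insert P s _ ih =>
    intro hs
    obtain ⟨k, Y, hk, h1, h2, h3⟩ := ih fun Q hQ => hs Q (Finset.mem_insert_of_mem hQ)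
    obtain rfl := hs P (Finset.mem_insert_self P s)
    obtain ⟨l, Z, hl, hZ, hZ1, hZ2⟩ := hF.exists_stableAt hS P Y h2
    have key : ∀ Q : Subgroup S, Nat.card P ≤ Nat.card Q → F.StableAt Y Q → F.StableAt Z Q := by
      intro Q hQ hY
      by_cases hPQ : F.IsConj P Q
      · exact hZ.of_isConj hPQ
      · intro R hR
        rw [hZ1 Q hPQ hQ, hZ1 R (fun h => hPQ (h.trans hR.symm)) (hR.card_eq ▸ hQ), hY R hR]
    refine ⟨l * k, Z, hp.not_dvd_mul hl hk, h1.trans hZ2, fun Q hQ => key Q hQ.le (h2 Q hQ), ?_⟩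
    intro Q hQ
    obtain rfl | hQs := Finset.mem_insert.1 hQ
    · exact hZ
    · exact key Q (hs Q hQ).ge (h3 Q hQs)

/-- Up to a factor prime to `p`, the averages of the marks of an element of the Burnside ring over
the conjugacy classes are the marks of a stable element. -/
theorem IsSaturated.exists_mem_burnside {p : ℕ} [Fact p.Prime] (hS : IsPGroup p S)
    (hF : F.IsSaturated p) (X : BurnsideRing S) :
    ∃ (k : ℕ) (Y : BurnsideRing S), ¬ p ∣ k ∧ Y ∈ F.burnside ∧ F.SameSums k X Y := by
  have hp : p.Prime := Fact.out
  -- For `j = 0` the condition is vacuous, as no subgroup has order above `|S|`; for `j = |S|` it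
  -- covers every subgroup.
  suffices h : ∀ j ≤ Nat.card S, ∃ (k : ℕ) (Y : BurnsideRing S), ¬ p ∣ k ∧ F.SameSums k X Y ∧
      ∀ Q : Subgroup S, Nat.card S - j < Nat.card Q → F.StableAt Y Q by
    obtain ⟨k, Y, hk, h1, h2⟩ := h _ le_rfl
    exact ⟨k, Y, hk, mem_burnside_iff.2 fun Q => h2 Q (by simp), h1⟩
  intro j
  induction j with
  | zero =>
    refine fun _ => ⟨1, X, hp.not_dvd_one, fun Q => by simp, fun Q hQ => ?_⟩
    have := Subgroup.card_le_card_group Q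
    omega
  | succ j ih =>
    intro hj
    obtain ⟨k, Y, hk, h1, h2⟩ := ih (by omega)
    obtain ⟨l, Z, hl, h3, h4⟩ := hF.exists_stableAt_card hS (Nat.card S - j) Y h2
    exact ⟨l * k, Z, hp.not_dvd_mul hl hk, h1.trans h3, fun Q hQ => h4 Q (by omega)⟩

/-! ### The projection onto the stable elements -/

theorem pMark_eq_of_isConj {p : ℕ} [Fact p.Prime] {X : PLocal p (BurnsideRing S)}
    (hX : X ∈ F.pBurnside p) (h : F.IsConj P Q) : pMark p Q X = pMark p P X := by
  obtain ⟨Y, rfl⟩ := hX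
  obtain ⟨n, Z, hn, hZ⟩ := exists_mul_eq_algebraMap p Y
  have hmap : (n : PLocal p (BurnsideRing S)) * PLocal.map p F.burnside.subtype Y =
      algebraMap _ _ (Z : BurnsideRing S) := by
    rw [← map_intCast (PLocal.map p F.burnside.subtype), ← map_mul, hZ, PLocal.map,
      IsLocalization.map_eq]
    rfl
  have hn0 : (n : ℚ) ≠ 0 := by
    rintro h0
    rw [Int.cast_eq_zero] at h0
    exact hn (h0 ▸ dvd_zero _)
  have h1 := congrArg (pMark p P) hmap
  have h2 := congrArg (pMark p Q) hmap
  rw [map_mul, map_intCast, pMark_algebraMap] at h1 h2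
  rw [(mem_burnside_iff.1 Z.2) P Q h, ← h1] at h2
  exact mul_left_cancel₀ hn0 h2

variable (F) in
/-- The average of the marks of `X` over the conjugacy class of `Q`. -/
noncomputable def averageMark (p : ℕ) [Fact p.Prime] (X : PLocal p (BurnsideRing S))
    (Q : Subgroup S) : ℚ :=
  1 / ((F.conjClass Q).card : ℚ) * ∑ Q' ∈ F.conjClass Q, pMark p Q' X

theorem averageMark_add {p : ℕ} [Fact p.Prime] (X Y : PLocal p (BurnsideRing S)) (Q : Subgroup S) :
    F.averageMark p (X + Y) Q = F.averageMark p X Q + F.averageMark p Y Q := by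
  simp only [averageMark, map_add, Finset.sum_add_distrib, mul_add]

/-- The marks of `A` are constant on the class and factor out of the average; this is the
`A(F)_(p)`-linearity of `π`. -/
theorem averageMark_mul {p : ℕ} [Fact p.Prime] {A : PLocal p (BurnsideRing S)}
    (hA : A ∈ F.pBurnside p) (X : PLocal p (BurnsideRing S)) (Q : Subgroup S) :
    F.averageMark p (A * X) Q = pMark p Q A * F.averageMark p X Q := by
  simp only [averageMark, map_mul]
  rw [Finset.sum_congr rfl fun Q' hQ' =>
    congrArg (· * pMark p Q' X) (pMark_eq_of_isConj hA (mem_conjClass.1 hQ')), ← Finset.mul_sum]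
  ring

theorem averageMark_eq {p : ℕ} [Fact p.Prime] {A : PLocal p (BurnsideRing S)}
    (hA : A ∈ F.pBurnside p) (Q : Subgroup S) : F.averageMark p A Q = pMark p Q A := by
  have h : ((F.conjClass Q).card : ℚ) ≠ 0 := by exact_mod_cast (card_conjClass_pos Q).ne'
  rw [averageMark, Finset.sum_congr rfl fun Q' hQ' =>
    pMark_eq_of_isConj hA (mem_conjClass.1 hQ'), Finset.sum_const, nsmul_eq_mul]
  field_simp

theorem IsSaturated.exists_pMark_eq_averageMark {p : ℕ} [Fact p.Prime] (hS : IsPGroup p S)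
    (hF : F.IsSaturated p) (X : PLocal p (BurnsideRing S)) :
    ∃ Y : F.pBurnside p, ∀ Q, pMark p Q (Y : PLocal p (BurnsideRing S)) = F.averageMark p X Q := by
  obtain ⟨n, Z, hn, hZ⟩ := exists_mul_eq_algebraMap p X
  obtain ⟨k, Y, hk, hY, hsum⟩ := hF.exists_mem_burnside hS Z
  have hkn : ¬ (p : ℤ) ∣ k * n :=
    (Nat.prime_iff_prime_int.1 Fact.out).not_dvd_mul (by exact_mod_cast hk) hn
  -- The inverse of `k n` is taken in `A(F)_(p)`, not merely in `A(S)_(p)`, so that `W` is an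
  -- element of `A(F)_(p)`.
  obtain ⟨u, hu⟩ := (isUnit_intCast (A := F.burnside) p hkn).exists_left_inv
  let W : PLocal p F.burnside := u * algebraMap F.burnside _ ⟨Y, hY⟩
  have hkn0 : ((k * n : ℤ) : ℚ) ≠ 0 := by
    rw [Int.cast_ne_zero]
    rintro h0
    exact hkn (h0 ▸ dvd_zero _)
  have hW : ((k * n : ℤ) : PLocal p (BurnsideRing S)) * PLocal.map p F.burnside.subtype W =
      algebraMap _ _ Y := by
    have h1 : ((k * n : ℤ) : PLocal p F.burnside) * W = algebraMap F.burnside _ ⟨Y, hY⟩ := by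
      rw [← mul_assoc, mul_comm _ u, hu, one_mul]
    rw [← map_intCast (PLocal.map p F.burnside.subtype), ← map_mul, h1, PLocal.map,
      IsLocalization.map_eq]
    rfl
  refine ⟨⟨_, W, rfl⟩, fun Q => ?_⟩
  have hav : F.averageMark p (algebraMap _ _ Y) Q =
      (k * n : ℤ) * F.averageMark p X Q := by
    have h1 : ∀ Q', ((n : ℤ) : ℚ) * pMark p Q' X = mark Q' Z := fun Q' => by
      rw [← pMark_algebraMap p, ← hZ, map_mul, map_intCast]
    have h2 := congrArg (Int.cast : ℤ → ℚ) (hsum Q)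
    push_cast at h2
    simp only [averageMark, pMark_algebraMap, h2, ← h1, ← Finset.mul_sum]
    push_cast
    ring
  have hYm : algebraMap (BurnsideRing S) (PLocal p (BurnsideRing S)) Y ∈ F.pBurnside p :=
    ⟨algebraMap F.burnside _ ⟨Y, hY⟩, by rw [PLocal.map, IsLocalization.map_eq]; rfl⟩
  rw [averageMark_eq hYm, ← hW, map_mul, map_intCast] at hav
  exact mul_left_cancel₀ hkn0 hav

end FusionSystem

theorem theoremA (p : ℕ) [Fact p.Prime] (S : Type u) [Group S] [Finite S] (hS : IsPGroup p S)
    (F : FusionSystem S) (hF : F.IsSaturated p) :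
    ∃ π : PLocal p (BurnsideRing S) →ₗ[F.pBurnside p] F.pBurnside p,
      (∀ (X : PLocal p (BurnsideRing S)) (Q : Subgroup S),
        BurnsideRing.pMark p Q (π X : PLocal p (BurnsideRing S)) =
          1 / ((F.conjClass Q).card : ℚ) *
            ∑ Q' ∈ F.conjClass Q, BurnsideRing.pMark p Q' X) ∧
      (∀ X Y : PLocal p (BurnsideRing S),
        (∀ Q : Subgroup S, BurnsideRing.pMark p Q Y =
          1 / ((F.conjClass Q).card : ℚ) *
            ∑ Q' ∈ F.conjClass Q, BurnsideRing.pMark p Q' X) →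
        Y = (π X : PLocal p (BurnsideRing S))) ∧
      ∀ Y : F.pBurnside p, π (Y : PLocal p (BurnsideRing S)) = Y := by
  choose f hf using hF.exists_pMark_eq_averageMark hS
  -- Additivity, linearity and the identity on stable elements all reduce to comparing averaged
  -- marks.
  have huniq : ∀ (X : PLocal p (BurnsideRing S)) (Y : F.pBurnside p),
      (∀ Q, BurnsideRing.pMark p Q (Y : PLocal p (BurnsideRing S)) = F.averageMark p X Q) →
      f X = Y := fun X Y h =>
    Subtype.ext (BurnsideRing.ext_pMark p fun Q => (hf X Q).trans (h Q).symm)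
  refine ⟨{ toFun := f, map_add' := fun X Y => huniq _ _ fun Q => ?_,
            map_smul' := fun A X => huniq _ _ fun Q => ?_ }, hf, fun X Y h => ?_, fun Y => ?_⟩
  · rw [Subring.coe_add, map_add, hf, hf, FusionSystem.averageMark_add]
  · rw [RingHom.id_apply, smul_eq_mul, Subring.coe_mul, map_mul, hf]
    exact (FusionSystem.averageMark_mul A.2 X Q).symm
  · exact BurnsideRing.ext_pMark p fun Q => (h Q).trans (hf X Q).symm
  · exact huniq _ _ fun Q => (FusionSystem.averageMark_eq Y.2 Q).symm
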